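/- Let $k$ be a field of characteristic zero and $V$ a $k$-vector space. A pre-Lie algebra is a vector space $X$ with a bilinear product $\star$ whose associator $\Phi(x,y,z)=(x\star y)\star z-x\star(y\star z)$ satisfies $\Phi(x,y,z)=\Phi(x,z,y)$; in a graded pre-Lie algebra the product adds degrees and $\Phi(x,y,z)=(-1)^{|y||z|}\Phi(x,z,y)$ for homogeneous $y,z$. Let $\mathsf{pL}(V)$ be the free pre-Lie algebra generated by $V$, let $\mathsf{pL}(V)_L$ be the Lie algebra on the space $\mathsf{pL}(V)$ with bracket $[x,y]=x\star y-y\star x$, and let $\mathsf{L}(V)\subset\mathsf{pL}(V)_L$ be the Lie subalgebra generated by $V$. Let $\mathsf{pL}(V,\circ)$ be the free graded pre-Lie algebra generated by $V$ placed in degree $0$ and one dummy generator $\circ$ placed in degree $+1$, and let $\mathsf{pL}^n(V)$ be the span of the monomials in it with exactly $n$ occurrences of $\circ$. Let $\mathsf{rpL}^*(V)=\mathsf{pL}(V,\circ)/(\circ\star\circ)$ be its quotient by the ideal generated by $\circ\star\circ$, with the induced grading; then $\mathsf{rpL}^0(V)=\mathsf{pL}(V)$ and $\mathsf{rpL}^1(V)=\mathsf{pL}^1(V)$.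 Let $d:\mathsf{rpL}^*(V)\to\mathsf{rpL}^{*+1}(V)$ be the unique linear map of degree $+1$ such that $d(v)=0$ for $v\in V$, $d(\circ)=0$ and $$d(a\star b)=d(a)\star b+(-1)^{|a|}\,a\star d(b)+\Phi(\circ,a,b)$$ for all $b$ and all homogeneous $a$ in $\mathsf{rpL}^*(V)$. Theorem. The subspace $\mathsf{L}(V)\subset\mathsf{pL}(V)$ equals the kernel of the degree-zero component of $d$: $$\mathsf{L}(V)=\operatorname{Ker}\bigl(d:\mathsf{pL}(V)\to\mathsf{pL}^1(V)\bigr).$$ -/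

import Mathlib

universe u v

noncomputable section

namespace PreLie

/-! ### Quotients of nonassociative algebras by generated ideals -/

section Ideal

variable (k : Type u) [CommRing k] {A : Type v} [NonUnitalNonAssocRing A] [Module k A]

/-- The two-sided ideal of the (nonassociative) `k`-algebra `A` generated by `s`: the smallest
`k`-submodule that contains `s` and is stable under all left and right multiplications. -/
def idealSpan (s : Set A) : Submodule k A :=
  sInf {J | s ⊆ J ∧ ∀ a : A, ∀ x ∈ J, a * x ∈ J ∧ x * a ∈ J}

variable {k}

theorem subset_idealSpan (s : Set A) : s ⊆ idealSpan k s := by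
  intro x hx
  simp only [idealSpan, SetLike.mem_coe, Submodule.mem_sInf]
  exact fun J hJ => hJ.1 hx

theorem idealSpan_le {s : Set A} {J : Submodule k A} (h : s ⊆ J)
    (hm : ∀ a : A, ∀ x ∈ J, a * x ∈ J ∧ x * a ∈ J) : idealSpan k s ≤ J :=
  sInf_le ⟨h, hm⟩

theorem mul_mem_idealSpan {s : Set A} (a : A) {x : A} (hx : x ∈ idealSpan k s) :
    a * x ∈ idealSpan k s := by
  simp only [idealSpan, Submodule.mem_sInf] at hx ⊢
  exact fun J hJ => (hJ.2 a x (hx J hJ)).1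

theorem mem_idealSpan_mul {s : Set A} (a : A) {x : A} (hx : x ∈ idealSpan k s) :
    x * a ∈ idealSpan k s := by
  simp only [idealSpan, Submodule.mem_sInf] at hx ⊢
  exact fun J hJ => (hJ.2 a x (hx J hJ)).2

variable (k)

/-- The quotient algebra of `A` by the two-sided ideal generated by `s`. -/
def AlgQuot (s : Set A) : Type v := A ⧸ idealSpan k s

namespace AlgQuot

variable (s : Set A)

instance : AddCommGroup (AlgQuot k s) := inferInstanceAs (AddCommGroup (A ⧸ idealSpan k s))

instance : Module k (AlgQuot k s) := inferInstanceAs (Module k (A ⧸ idealSpan k s))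

/-- The quotient map. -/
def mk : A →ₗ[k] AlgQuot k s := (idealSpan k s).mkQ

theorem mk_surjective : Function.Surjective (mk k s) := Submodule.mkQ_surjective _

theorem mk_eq_zero {x : A} : mk k s x = 0 ↔ x ∈ idealSpan k s :=
  Submodule.Quotient.mk_eq_zero _

theorem mk_eq_mk {x y : A} : mk k s x = mk k s y ↔ x - y ∈ idealSpan k s :=
  Submodule.Quotient.eq _

/-- A linear map on `A` that vanishes on the ideal descends to the quotient. -/
def liftLin {N : Type*} [AddCommGroup N] [Module k N] (f : A →ₗ[k] N)
    (h : ∀ x ∈ idealSpan k s, f x = 0) : AlgQuot k s →ₗ[k] N :=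
  (idealSpan k s).liftQ f fun x hx => h x hx

@[simp]
theorem liftLin_mk {N : Type*} [AddCommGroup N] [Module k N] (f : A →ₗ[k] N)
    (h : ∀ x ∈ idealSpan k s, f x = 0) (x : A) : liftLin k s f h (mk k s x) = f x := rfl

/-- The product of the quotient algebra: the class of `x` times the class of `y` is the class
of `x * y`. -/
instance : Mul (AlgQuot k s) where
  mul := Quotient.map₂ (· * ·) (by
    intro a b h c d h'
    have h1 : a - b ∈ idealSpan k s := (Submodule.quotientRel_def _).1 h
    have h2 : c - d ∈ idealSpan k s := (Submodule.quotientRel_def _).1 h'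
    refine (Submodule.quotientRel_def _).2 ?_
    have : a * c - b * d = (a - b) * c + b * (c - d) := by
      rw [sub_mul, mul_sub]; abel
    change a * c - b * d ∈ _
    rw [this]
    exact add_mem (mem_idealSpan_mul c h1) (mul_mem_idealSpan b h2))

@[simp]
theorem mk_mul (x y : A) : mk k s (x * y) = mk k s x * mk k s y := rfl

instance : NonUnitalNonAssocRing (AlgQuot k s) where
  left_distrib a b c := by
    obtain ⟨a, rfl⟩ := mk_surjective k s a
    obtain ⟨b, rfl⟩ := mk_surjective k s b
    obtain ⟨c, rfl⟩ := mk_surjective k s c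
    simp only [← mk_mul, ← map_add, mul_add]
  right_distrib a b c := by
    obtain ⟨a, rfl⟩ := mk_surjective k s a
    obtain ⟨b, rfl⟩ := mk_surjective k s b
    obtain ⟨c, rfl⟩ := mk_surjective k s c
    simp only [← mk_mul, ← map_add, add_mul]
  zero_mul a := by
    obtain ⟨a, rfl⟩ := mk_surjective k s a
    rw [← map_zero (mk k s), ← mk_mul, zero_mul]
  mul_zero a := by
    obtain ⟨a, rfl⟩ := mk_surjective k s a
    rw [← map_zero (mk k s), ← mk_mul, mul_zero]

instance [IsScalarTower k A A] : IsScalarTower k (AlgQuot k s) (AlgQuot k s) where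
  smul_assoc r a b := by
    obtain ⟨a, rfl⟩ := mk_surjective k s a
    obtain ⟨b, rfl⟩ := mk_surjective k s b
    simp only [smul_eq_mul, ← map_smul, ← mk_mul, smul_mul_assoc]

instance [SMulCommClass k A A] : SMulCommClass k (AlgQuot k s) (AlgQuot k s) where
  smul_comm r a b := by
    obtain ⟨a, rfl⟩ := mk_surjective k s a
    obtain ⟨b, rfl⟩ := mk_surjective k s b
    simp only [smul_eq_mul, ← map_smul, ← mk_mul, mul_smul_comm]

theorem mk_associator (x y z : A) :
    mk k s (associator x y z) = associator (mk k s x) (mk k s y) (mk k s z) := by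
  simp [associator_apply]

/-- An algebra homomorphism that vanishes on the generators descends to the quotient. -/
def lift [IsScalarTower k A A] [SMulCommClass k A A] {B : Type*} [NonUnitalNonAssocRing B]
    [Module k B] (φ : A →ₙₐ[k] B) (h : ∀ x ∈ s, φ x = 0) : AlgQuot k s →ₙₐ[k] B where
  toFun := liftLin k s (φ : A →ₗ[k] B) (by
    have : idealSpan k s ≤ LinearMap.ker (φ : A →ₗ[k] B) := idealSpan_le
      (fun x hx => by simpa using h x hx)
      (fun a x hx => by
        have hx' : φ x = 0 := by simpa using hx
        simp [hx'])
    exact fun x hx => this hx)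
  map_smul' r x := map_smul _ r x
  map_zero' := map_zero _
  map_add' x y := map_add _ x y
  map_mul' x y := by
    obtain ⟨x, rfl⟩ := mk_surjective k s x
    obtain ⟨y, rfl⟩ := mk_surjective k s y
    rw [← mk_mul]
    exact map_mul φ x y

@[simp]
theorem lift_mk [IsScalarTower k A A] [SMulCommClass k A A] {B : Type*} [NonUnitalNonAssocRing B]
    [Module k B] (φ : A →ₙₐ[k] B) (h : ∀ x ∈ s, φ x = 0) (x : A) :
    lift k s φ h (mk k s x) = φ x := rfl

end AlgQuot

end Ideal

section AssociatorLinear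

variable {k : Type u} [CommRing k] {A : Type v} [NonUnitalNonAssocRing A] [Module k A]

theorem associator_add_left (x x' y z : A) :
    associator (x + x') y z = associator x y z + associator x' y z := by
  simp only [associator_apply, add_mul]; abel

theorem associator_add_mid (x y y' z : A) :
    associator x (y + y') z = associator x y z + associator x y' z := by
  simp only [associator_apply, add_mul, mul_add]; abel

theorem associator_add_right (x y z z' : A) :
    associator x y (z + z') = associator x y z + associator x y z' := by
  simp only [associator_apply, mul_add]; abel

theorem associator_smul_left [IsScalarTower k A A] (r : k) (x y z : A) :
    associator (r • x) y z = r • associator x y z := by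
  simp only [associator_apply, smul_mul_assoc, smul_sub]

theorem associator_smul_mid [IsScalarTower k A A] [SMulCommClass k A A] (r : k) (x y z : A) :
    associator x (r • y) z = r • associator x y z := by
  simp only [associator_apply, smul_mul_assoc, mul_smul_comm, smul_sub]

theorem associator_smul_right [SMulCommClass k A A] (r : k) (x y z : A) :
    associator x y (r • z) = r • associator x y z := by
  simp only [associator_apply, mul_smul_comm, smul_sub]

end AssociatorLinear

/-! ### Monomials in `V` and a dummy generator of degree one -/

section Monomials

variable (k : Type u) [CommRing k] {V : Type v}

/-- Nonassociative monomials in the elements of `V` (`some v`) and the dummy generator `∘`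
(`none`). -/
abbrev Mon (V : Type v) : Type v := FreeMagma (Option V)

/-- The number of occurrences of the dummy generator in a monomial, which is its degree. -/
def deg : Mon V → ℕ
  | FreeMagma.of none => 1
  | FreeMagma.of (some _) => 0
  | FreeMagma.mul x y => deg x + deg y

@[simp] theorem deg_none : deg (FreeMagma.of (none : Option V)) = 1 := rfl
@[simp] theorem deg_some (v : V) : deg (FreeMagma.of (some v)) = 0 := rfl
@[simp] theorem deg_mul (x y : Mon V) : deg (x * y) = deg x + deg y := rfl

/-- A monomial as an element of the free nonassociative algebra. -/
def mono (m : Mon V) : FreeNonUnitalNonAssocAlgebra k (Option V) := MonoidAlgebra.single m 1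

theorem mono_mul (m n : Mon V) : mono k (m * n) = mono k m * mono k n := by
  simp [mono, MonoidAlgebra.single_mul_single]

theorem single_eq (m : Mon V) (r : k) :
    (MonoidAlgebra.single m r : FreeNonUnitalNonAssocAlgebra k (Option V)) = r • mono k m := by
  simp [mono]

end Monomials

variable (k : Type u) [CommRing k] (V : Type v) [AddCommGroup V] [Module k V]

/-! ### The free pre-Lie algebra on a vector space -/

/-- The relations that define the free pre-Lie algebra: linearity of the inclusion of `V`, and
symmetry of the associator in the last two variables. -/
inductive FreePreLieRel : FreeNonUnitalNonAssocAlgebra k V → Prop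
  | add (v w : V) : FreePreLieRel
      (FreeNonUnitalNonAssocAlgebra.of k (v + w) - FreeNonUnitalNonAssocAlgebra.of k v
        - FreeNonUnitalNonAssocAlgebra.of k w)
  | smul (c : k) (v : V) : FreePreLieRel
      (FreeNonUnitalNonAssocAlgebra.of k (c • v) - c • FreeNonUnitalNonAssocAlgebra.of k v)
  | assoc (x y z : FreeNonUnitalNonAssocAlgebra k V) : FreePreLieRel
      (associator x y z - associator x z y)

/-- The free (right) pre-Lie algebra `pL(V)` generated by the vector space `V`. -/
abbrev FreePreLie : Type (max u v) := AlgQuot k {x | FreePreLieRel k V x}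

namespace FreePreLie

instance : RightPreLieRing (FreePreLie k V) where
  assoc_symm' x y z := by
    obtain ⟨x, rfl⟩ := AlgQuot.mk_surjective k _ x
    obtain ⟨y, rfl⟩ := AlgQuot.mk_surjective k _ y
    obtain ⟨z, rfl⟩ := AlgQuot.mk_surjective k _ z
    rw [← AlgQuot.mk_associator, ← AlgQuot.mk_associator, AlgQuot.mk_eq_mk]
    exact subset_idealSpan _ (FreePreLieRel.assoc x y z)

instance : RightPreLieAlgebra k (FreePreLie k V) where

/-- The canonical map `V → pL(V)`. -/
def ι : V →ₗ[k] FreePreLie k V where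
  toFun v := AlgQuot.mk k _ (FreeNonUnitalNonAssocAlgebra.of k v)
  map_add' v w := by
    rw [← map_add, AlgQuot.mk_eq_mk, ← sub_sub]
    exact subset_idealSpan _ (FreePreLieRel.add v w)
  map_smul' c v := by
    rw [RingHom.id_apply, ← map_smul, AlgQuot.mk_eq_mk]
    exact subset_idealSpan _ (FreePreLieRel.smul c v)

end FreePreLie

/-- The Lie algebra `L(V)` of Lie elements: the Lie subalgebra generated by `V` in `pL(V)` with
the commutator bracket `⁅x, y⁆ = x * y - y * x`. -/
def lieElements : LieSubalgebra k (FreePreLie k V) :=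
  LieSubalgebra.lieSpan k (FreePreLie k V) (Set.range (FreePreLie.ι k V))

/-! ### The free graded pre-Lie algebra on `V` and the dummy generator -/

/-- The relations that define the free graded pre-Lie algebra on `V` (in degree `0`) and `∘`
(in degree `1`): linearity of the inclusion of `V`, and graded symmetry of the associator in the
last two variables, `Φ(x, y, z) = (-1) ^ (|y| |z|) Φ(x, z, y)`. -/
inductive GradedRel : FreeNonUnitalNonAssocAlgebra k (Option V) → Prop
  | add (v w : V) : GradedRel
      (mono k (.of (some (v + w))) - mono k (.of (some v)) - mono k (.of (some w)))
  | smul (c : k) (v : V) : GradedRel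
      (mono k (.of (some (c • v))) - c • mono k (.of (some v)))
  | assoc (x y z : Mon V) : GradedRel
      (associator (mono k x) (mono k y) (mono k z)
        - (-1 : k) ^ (deg y * deg z) • associator (mono k x) (mono k z) (mono k y))

/-- The free graded pre-Lie algebra `pL(V, ∘)`. -/
abbrev GradedFree : Type (max u v) := AlgQuot k {x | GradedRel k V x}

namespace GradedFree

variable {V} in
/-- The class of a monomial in `pL(V, ∘)`. -/
def ofMon (m : Mon V) : GradedFree k V := AlgQuot.mk k _ (mono k m)

/-- The dummy generator `∘`. -/
def dummy : GradedFree k V := ofMon k (.of none)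

theorem ofMon_mul (m n : Mon V) : ofMon k (m * n) = ofMon k m * ofMon k n := by
  simp [ofMon, mono_mul]

/-- `pLⁿ(V)`: the span of the monomials with exactly `n` occurrences of the dummy generator. -/
def gr (n : ℕ) : Submodule k (GradedFree k V) :=
  Submodule.span k {x | ∃ m : Mon V, deg m = n ∧ ofMon k m = x}

/-- The canonical map `V → pL(V, ∘)`. -/
def ι : V →ₗ[k] GradedFree k V where
  toFun v := ofMon k (.of (some v))
  map_add' v w := by
    rw [ofMon, ofMon, ofMon, ← map_add, AlgQuot.mk_eq_mk, ← sub_sub]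
    exact subset_idealSpan _ (GradedRel.add v w)
  map_smul' c v := by
    rw [ofMon, ofMon, RingHom.id_apply, ← map_smul, AlgQuot.mk_eq_mk]
    exact subset_idealSpan _ (GradedRel.smul c v)

variable {k V}

theorem ofMon_mem_gr (m : Mon V) : ofMon k m ∈ gr k V (deg m) :=
  Submodule.subset_span ⟨m, rfl, rfl⟩

/-- Induction over linear combinations of monomials. -/
theorem induction_mon {p : GradedFree k V → Prop} (h0 : p 0) (hadd : ∀ x y, p x → p y → p (x + y))
    (hmon : ∀ (r : k) (m : Mon V), p (r • ofMon k m)) (x : GradedFree k V) : p x := by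
  obtain ⟨a, rfl⟩ := AlgQuot.mk_surjective k _ x
  induction a using MonoidAlgebra.induction_linear with
  | zero => simpa using h0
  | add a b ha hb => simpa using hadd _ _ ha hb
  | single m r =>
    rw [single_eq, map_smul]
    exact hmon r m

theorem mul_mem_gr {m n : ℕ} {x y : GradedFree k V} (hx : x ∈ gr k V m) (hy : y ∈ gr k V n) :
    x * y ∈ gr k V (m + n) := by
  induction hx using Submodule.span_induction with
  | zero => simp
  | add a b _ _ ha hb => rw [add_mul]; exact add_mem ha hb
  | smul r a _ ha => rw [smul_mul_assoc]; exact Submodule.smul_mem _ _ ha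
  | mem a ha =>
    obtain ⟨p, rfl, rfl⟩ := ha
    induction hy using Submodule.span_induction with
    | zero => simp
    | add a b _ _ ha hb => rw [mul_add]; exact add_mem ha hb
    | smul r a _ ha => rw [mul_smul_comm]; exact Submodule.smul_mem _ _ ha
    | mem b hb =>
      obtain ⟨q, rfl, rfl⟩ := hb
      rw [← ofMon_mul]
      exact ofMon_mem_gr (p * q)

theorem assoc_mon (x y z : Mon V) : associator (ofMon k x) (ofMon k y) (ofMon k z) =
    (-1 : k) ^ (deg y * deg z) • associator (ofMon k x) (ofMon k z) (ofMon k y) := by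
  have h := (AlgQuot.mk_eq_zero k {x | GradedRel k V x}).2
    (subset_idealSpan _ (GradedRel.assoc x y z))
  rwa [map_sub, map_smul, AlgQuot.mk_associator, AlgQuot.mk_associator, sub_eq_zero] at h

/-- Graded symmetry of the associator of `pL(V, ∘)`. -/
theorem assoc_symm {m n : ℕ} (x : GradedFree k V) {y z : GradedFree k V} (hy : y ∈ gr k V m)
    (hz : z ∈ gr k V n) : associator x y z = (-1 : k) ^ (m * n) • associator x z y := by
  induction x using induction_mon with
  | h0 => simp [associator_apply]
  | hadd x x' hx hx' => rw [associator_add_left, associator_add_left, hx, hx', smul_add]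
  | hmon r p =>
    rw [associator_smul_left, associator_smul_left, smul_comm _ r]
    congr 1
    induction hy using Submodule.span_induction with
    | zero => simp [associator_apply]
    | add a b _ _ ha hb => rw [associator_add_mid, associator_add_right, ha, hb, smul_add]
    | smul r a _ ha => rw [associator_smul_mid, associator_smul_right, ha, smul_comm]
    | mem a ha =>
      obtain ⟨q, rfl, rfl⟩ := ha
      induction hz using Submodule.span_induction with
      | zero => simp [associator_apply]
      | add a b _ _ ha hb => rw [associator_add_mid, associator_add_right, ha, hb, smul_add]
      | smul r a _ ha => rw [associator_smul_mid, associator_smul_right, ha, smul_comm]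
      | mem b hb =>
        obtain ⟨t, rfl, rfl⟩ := hb
        exact assoc_mon p q t

/-! #### The sign automorphism -/

variable (k V)

/-- The images of the generators under the sign automorphism: `v ↦ v` and `∘ ↦ -∘`. -/
def signGen : Option V → GradedFree k V
  | none => -dummy k V
  | some v => ι k V v

/-- The sign automorphism on the free nonassociative algebra. -/
def signAux : FreeNonUnitalNonAssocAlgebra k (Option V) →ₙₐ[k] GradedFree k V :=
  FreeNonUnitalNonAssocAlgebra.lift k (signGen k V)

theorem signAux_mono (m : Mon V) : signAux k V (mono k m) = (-1 : k) ^ deg m • ofMon k m := by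
  induction m using FreeMagma.recOnMul with
  | ih1 g =>
    have : signAux k V (mono k (.of g)) = signGen k V g :=
      FreeNonUnitalNonAssocAlgebra.lift_of_apply k _ g
    rw [this]
    cases g with
    | none => simp [signGen, dummy]
    | some v => simp [signGen, ι]
  | ih2 x y hx hy =>
    rw [mono_mul, map_mul, hx, hy, ofMon_mul, deg_mul, smul_mul_smul_comm, pow_add]

/-- The sign automorphism of `pL(V, ∘)`: multiplication by `(-1) ^ n` in degree `n`. -/
def sign : GradedFree k V →ₙₐ[k] GradedFree k V :=
  AlgQuot.lift k _ (signAux k V) (by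
    intro x hx
    cases hx with
    | add v w =>
      simp only [map_sub, signAux_mono, deg_some, pow_zero, one_smul]
      exact sub_eq_zero.2 (sub_eq_iff_eq_add'.2 ((ι k V).map_add v w))
    | smul c v =>
      simp only [map_sub, map_smul, signAux_mono, deg_some, pow_zero, one_smul]
      exact sub_eq_zero.2 ((ι k V).map_smul c v)
    | assoc x y z =>
      simp only [map_sub, map_smul, associator_apply, map_mul, signAux_mono]
      rw [← associator_apply, ← associator_apply]
      simp only [associator_smul_left, associator_smul_mid, associator_smul_right]
      rw [assoc_mon x y z]
      simp only [smul_smul]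
      rw [← sub_smul]
      convert zero_smul k _ using 2
      ring)

variable {k V}

theorem sign_ofMon (m : Mon V) : sign k V (ofMon k m) = (-1 : k) ^ deg m • ofMon k m :=
  signAux_mono k V m

theorem sign_of_mem {n : ℕ} {x : GradedFree k V} (hx : x ∈ gr k V n) :
    sign k V x = (-1 : k) ^ n • x := by
  induction hx using Submodule.span_induction with
  | zero => simp
  | add a b _ _ ha hb => rw [map_add, ha, hb, smul_add]
  | smul r a _ ha => rw [map_smul, ha, smul_comm]
  | mem a ha =>
    obtain ⟨q, rfl, rfl⟩ := ha
    exact sign_ofMon q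

/-! #### The differential of `pL(V, ∘)` -/

variable (k) in
/-- The differential on monomials, by recursion: it vanishes on the generators, and
`d(x * y) = d(x) * y + (-1) ^ |x| x * d(y) + Φ(∘, x, y)`. -/
def dMon : Mon V → GradedFree k V
  | FreeMagma.of _ => 0
  | FreeMagma.mul x y => dMon x * ofMon k y + (-1 : k) ^ deg x • (ofMon k x * dMon y)
      + associator (dummy k V) (ofMon k x) (ofMon k y)

theorem dMon_mul (x y : Mon V) : dMon k (x * y) =
    dMon k x * ofMon k y + (-1 : k) ^ deg x • (ofMon k x * dMon k y)
      + associator (dummy k V) (ofMon k x) (ofMon k y) := rfl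

theorem dummy_mem : dummy k V ∈ gr k V 1 := ofMon_mem_gr (k := k) (.of (none : Option V))

theorem associator_mem {l m n : ℕ} {x y z : GradedFree k V} (hx : x ∈ gr k V l)
    (hy : y ∈ gr k V m) (hz : z ∈ gr k V n) : associator x y z ∈ gr k V (l + m + n) := by
  rw [associator_apply]
  refine sub_mem (mul_mem_gr (mul_mem_gr hx hy) hz) ?_
  rw [add_assoc]
  exact mul_mem_gr hx (mul_mem_gr hy hz)

theorem dMon_mem (m : Mon V) : dMon k m ∈ gr k V (deg m + 1) := by
  induction m using FreeMagma.recOnMul with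
  | ih1 g => exact zero_mem _
  | ih2 x y hx hy =>
    rw [dMon_mul, deg_mul]
    refine add_mem (add_mem ?_ (Submodule.smul_mem _ _ ?_)) ?_
    · convert mul_mem_gr hx (ofMon_mem_gr y) using 1; congr 1; omega
    · rw [add_assoc]; exact mul_mem_gr (ofMon_mem_gr x) hy
    · convert associator_mem dummy_mem (ofMon_mem_gr x) (ofMon_mem_gr y) using 1; congr 1; omega

variable (k V) in
/-- The linear extension of `dMon` to the free nonassociative algebra. -/
def dAux : FreeNonUnitalNonAssocAlgebra k (Option V) →ₗ[k] GradedFree k V :=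
  (MonoidAlgebra.basis (Mon V) k).constr k (dMon k)

theorem dAux_mono (m : Mon V) : dAux k V (mono k m) = dMon k m :=
  (MonoidAlgebra.basis (Mon V) k).constr_basis k (dMon k) m

theorem dAux_mul (a b : FreeNonUnitalNonAssocAlgebra k (Option V)) :
    dAux k V (a * b) = dAux k V a * AlgQuot.mk k _ b
      + sign k V (AlgQuot.mk k _ a) * dAux k V b
      + associator (dummy k V) (AlgQuot.mk k _ a) (AlgQuot.mk k _ b) := by
  induction a using MonoidAlgebra.induction_linear with
  | zero => simp [associator_apply]
  | add a a' ha ha' =>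
    simp only [add_mul, map_add, associator_add_mid, ha, ha']; abel
  | single m r =>
    rw [single_eq, smul_mul_assoc]
    simp only [map_smul, associator_smul_mid, smul_mul_assoc, ← smul_add]
    congr 1
    induction b using MonoidAlgebra.induction_linear with
    | zero => simp [associator_apply]
    | add a a' ha ha' =>
      simp only [mul_add, map_add, associator_add_right, ha, ha']; abel
    | single n s =>
      rw [single_eq, mul_smul_comm]
      simp only [map_smul, associator_smul_right, mul_smul_comm, ← smul_add]
      congr 1
      rw [← mono_mul, dAux_mono, dAux_mono, dAux_mono, dMon_mul]
      have := sign_ofMon (k := k) m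
      simp only [ofMon] at this ⊢
      rw [this, smul_mul_assoc]

theorem dAux_associator (a b c : FreeNonUnitalNonAssocAlgebra k (Option V)) :
    dAux k V (associator a b c) =
      associator (dAux k V a) (AlgQuot.mk k _ b) (AlgQuot.mk k _ c)
      + associator (sign k V (AlgQuot.mk k _ a)) (dAux k V b) (AlgQuot.mk k _ c)
      + associator (sign k V (AlgQuot.mk k _ a)) (sign k V (AlgQuot.mk k _ b)) (dAux k V c)
      - sign k V (AlgQuot.mk k _ a)
          * associator (dummy k V) (AlgQuot.mk k _ b) (AlgQuot.mk k _ c)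
      + associator (dummy k V * AlgQuot.mk k _ a) (AlgQuot.mk k _ b) (AlgQuot.mk k _ c)
      - dummy k V * associator (AlgQuot.mk k _ a) (AlgQuot.mk k _ b) (AlgQuot.mk k _ c) := by
  simp only [associator_apply, map_sub, dAux_mul, AlgQuot.mk_mul, map_mul, add_mul, mul_add,
    sub_mul, mul_sub]
  abel

theorem dAux_rel {x : FreeNonUnitalNonAssocAlgebra k (Option V)} (hx : GradedRel k V x) :
    dAux k V x = 0 := by
  cases hx with
  | add v w => simp [dAux_mono, dMon]
  | smul c v => simp [dAux_mono, dMon]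
  | assoc x y z =>
    have hsx := sign_ofMon (k := k) x
    have hsy := sign_ofMon (k := k) y
    have hsz := sign_ofMon (k := k) z
    have hx := ofMon_mem_gr (k := k) x
    have hy := ofMon_mem_gr (k := k) y
    have hz := ofMon_mem_gr (k := k) z
    have h1 := assoc_symm (dMon k x) hy hz
    have h2 := assoc_symm (ofMon k x) (dMon_mem y) hz
    have h3 := assoc_symm (ofMon k x) hy (dMon_mem z)
    have h4 := assoc_symm (dummy k V) hy hz
    have h5 := assoc_symm (dummy k V * ofMon k x) hy hz
    have h6 := assoc_symm (ofMon k x) hy hz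
    rw [map_sub, map_smul, dAux_associator, dAux_associator]
    simp only [dAux_mono]
    change associator (dMon k x) (ofMon k y) (ofMon k z)
      + associator (sign k V (ofMon k x)) (dMon k y) (ofMon k z)
      + associator (sign k V (ofMon k x)) (sign k V (ofMon k y)) (dMon k z)
      - sign k V (ofMon k x) * associator (dummy k V) (ofMon k y) (ofMon k z)
      + associator (dummy k V * ofMon k x) (ofMon k y) (ofMon k z)
      - dummy k V * associator (ofMon k x) (ofMon k y) (ofMon k z)
      - (-1 : k) ^ (deg y * deg z) • (associator (dMon k x) (ofMon k z) (ofMon k y)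
      + associator (sign k V (ofMon k x)) (dMon k z) (ofMon k y)
      + associator (sign k V (ofMon k x)) (sign k V (ofMon k z)) (dMon k y)
      - sign k V (ofMon k x) * associator (dummy k V) (ofMon k z) (ofMon k y)
      + associator (dummy k V * ofMon k x) (ofMon k z) (ofMon k y)
      - dummy k V * associator (ofMon k x) (ofMon k z) (ofMon k y)) = 0
    rw [hsx, hsy, hsz]
    simp only [associator_smul_left, associator_smul_mid, smul_mul_assoc, h1, h2, h3, h4, h5, h6,
      mul_smul_comm]
    have e (n : ℕ) : (-1 : k) ^ n * (-1 : k) ^ n = 1 := by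
      rw [← mul_pow]; simp
    have e1 : (-1 : k) ^ ((deg y + 1) * deg z) = (-1) ^ (deg y * deg z) * (-1) ^ deg z := by ring
    have e2 : (-1 : k) ^ deg y * (-1 : k) ^ (deg y * (deg z + 1)) = (-1) ^ (deg y * deg z) := by
      rw [mul_add, pow_add, mul_one, mul_left_comm, e, mul_one]
    rw [e1, smul_comm ((-1 : k) ^ deg y) ((-1 : k) ^ deg x),
      smul_smul ((-1 : k) ^ deg y) ((-1 : k) ^ (deg y * (deg z + 1))), e2]
    module

/-- The differential of `pL(V, ∘)` vanishes on the ideal of relations. -/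
theorem dAux_ideal : ∀ x ∈ idealSpan k {x | GradedRel k V x}, dAux k V x = 0 := by
  have : idealSpan k {x | GradedRel k V x} ≤
      idealSpan k {x | GradedRel k V x} ⊓ LinearMap.ker (dAux k V) := by
    refine idealSpan_le (fun x hx => ⟨subset_idealSpan _ hx, dAux_rel hx⟩) ?_
    rintro a x ⟨hx, hd⟩
    have hx' := (AlgQuot.mk_eq_zero k {x | GradedRel k V x}).2 hx
    have hd' : dAux k V x = 0 := hd
    refine ⟨⟨mul_mem_idealSpan a hx, ?_⟩, ⟨mem_idealSpan_mul a hx, ?_⟩⟩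
    · change dAux k V (a * x) = 0
      rw [dAux_mul, hx', hd']; simp [associator_apply]
    · change dAux k V (x * a) = 0
      rw [dAux_mul, hx', hd']; simp [associator_apply]
  exact fun x hx => (this hx).2

variable (k V) in
/-- The differential of `pL(V, ∘)`. -/
def dTilde : GradedFree k V →ₗ[k] GradedFree k V := AlgQuot.liftLin k _ (dAux k V) dAux_ideal

theorem dTilde_ofMon (m : Mon V) : dTilde k V (ofMon k m) = dMon k m := dAux_mono m

theorem dTilde_mul (x y : GradedFree k V) : dTilde k V (x * y) =
    dTilde k V x * y + sign k V x * dTilde k V y + associator (dummy k V) x y := by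
  obtain ⟨x, rfl⟩ := AlgQuot.mk_surjective k _ x
  obtain ⟨y, rfl⟩ := AlgQuot.mk_surjective k _ y
  exact dAux_mul x y

/-! #### The projections onto the homogeneous components -/

variable (k V) in
/-- The projection onto degree `n`, on the free nonassociative algebra. -/
def projAux (n : ℕ) : FreeNonUnitalNonAssocAlgebra k (Option V) →ₗ[k] GradedFree k V :=
  (MonoidAlgebra.basis (Mon V) k).constr k fun m => if deg m = n then ofMon k m else 0

theorem projAux_mono (n : ℕ) (m : Mon V) :
    projAux k V n (mono k m) = if deg m = n then ofMon k m else 0 :=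
  (MonoidAlgebra.basis (Mon V) k).constr_basis k _ m

theorem projAux_mul (n : ℕ) (a b : FreeNonUnitalNonAssocAlgebra k (Option V)) :
    projAux k V n (a * b) =
      ∑ p ∈ Finset.HasAntidiagonal.antidiagonal n, projAux k V p.1 a * projAux k V p.2 b := by
  induction a using MonoidAlgebra.induction_linear with
  | zero => simp
  | add a a' ha ha' => simp only [add_mul, map_add, ha, ha', Finset.sum_add_distrib]
  | single m r =>
    rw [single_eq, smul_mul_assoc]
    simp only [map_smul, smul_mul_assoc, ← Finset.smul_sum]
    congr 1
    induction b using MonoidAlgebra.induction_linear with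
    | zero => simp
    | add a a' ha ha' => simp only [mul_add, map_add, ha, ha', Finset.sum_add_distrib]
    | single l s =>
      rw [single_eq, mul_smul_comm]
      simp only [map_smul, mul_smul_comm, ← Finset.smul_sum]
      congr 1
      rw [← mono_mul]
      simp only [projAux_mono]
      by_cases h : deg (m * l) = n
      · rw [if_pos h, Finset.sum_eq_single (deg m, deg l)]
        · simp [ofMon_mul]
        · rintro ⟨p, q⟩ _ hne
          dsimp only
          split_ifs with h1 h2
          · subst h1 h2; exact absurd rfl hne
          all_goals simp
        · intro h'
          exact absurd (Finset.HasAntidiagonal.mem_antidiagonal.2 h) h'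
      · rw [if_neg h]
        refine (Finset.sum_eq_zero ?_).symm
        rintro ⟨p, q⟩ hpq
        have := Finset.HasAntidiagonal.mem_antidiagonal.1 hpq
        dsimp only at this ⊢
        split_ifs with h1 h2
        · exact absurd (by rw [deg_mul, h1, h2, this]) h
        all_goals simp

theorem projAux_rel (n : ℕ) {x : FreeNonUnitalNonAssocAlgebra k (Option V)}
    (hx : GradedRel k V x) : projAux k V n x = 0 := by
  cases hx with
  | add v w =>
    have e (u : V) : projAux k V n (mono k (.of (some u))) = if 0 = n then ι k V u else 0 :=
      projAux_mono n _
    simp only [map_sub, e]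
    by_cases hn : 0 = n
    · simp only [if_pos hn]
      exact sub_eq_zero.2 (sub_eq_iff_eq_add'.2 ((ι k V).map_add v w))
    · simp [hn]
  | smul c v =>
    have e (u : V) : projAux k V n (mono k (.of (some u))) = if 0 = n then ι k V u else 0 :=
      projAux_mono n _
    simp only [map_sub, map_smul, e]
    by_cases hn : 0 = n
    · simp only [if_pos hn, sub_self]
    · simp only [if_neg hn, smul_zero, sub_zero]
  | assoc x y z =>
    have h1 : deg (x * y * z) = deg x + deg y + deg z := rfl
    have h2 : deg (x * (y * z)) = deg x + deg y + deg z := (add_assoc _ _ _).symm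
    have h3 : deg (x * z * y) = deg x + deg y + deg z := add_right_comm _ _ _
    have h4 : deg (x * (z * y)) = deg x + deg y + deg z := by
      rw [deg_mul, deg_mul, add_comm (deg z), add_assoc]
    simp only [associator_apply, ← mono_mul, map_sub, map_smul, projAux_mono]
    by_cases hn : deg x + deg y + deg z = n
    · rw [if_pos (h1.trans hn), if_pos (h2.trans hn), if_pos (h3.trans hn), if_pos (h4.trans hn)]
      simp only [ofMon_mul]
      exact sub_eq_zero.2 (assoc_mon x y z)
    · rw [if_neg (h1 ▸ hn), if_neg (h2 ▸ hn), if_neg (h3 ▸ hn), if_neg (h4 ▸ hn)]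
      simp

theorem projAux_ideal (n : ℕ) :
    ∀ x ∈ idealSpan k {x | GradedRel k V x}, projAux k V n x = 0 := by
  have : idealSpan k {x | GradedRel k V x} ≤ ⨅ n, LinearMap.ker (projAux k V n) := by
    refine idealSpan_le (fun x hx => ?_) ?_
    · simp only [SetLike.mem_coe, Submodule.mem_iInf]
      exact fun n => projAux_rel n hx
    · intro a x hx
      simp only [Submodule.mem_iInf, LinearMap.mem_ker] at hx ⊢
      exact ⟨fun n => by rw [projAux_mul]; simp [hx], fun n => by rw [projAux_mul]; simp [hx]⟩
  intro x hx
  have h := this hx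
  simp only [Submodule.mem_iInf, LinearMap.mem_ker] at h
  exact h n

variable (k V) in
/-- The projection of `pL(V, ∘)` onto its component of degree `n`. -/
def proj (n : ℕ) : GradedFree k V →ₗ[k] GradedFree k V :=
  AlgQuot.liftLin k _ (projAux k V n) (projAux_ideal n)

theorem proj_ofMon (n : ℕ) (m : Mon V) :
    proj k V n (ofMon k m) = if deg m = n then ofMon k m else 0 := projAux_mono n m

theorem proj_mul (n : ℕ) (x y : GradedFree k V) :
    proj k V n (x * y) = ∑ p ∈ Finset.HasAntidiagonal.antidiagonal n, proj k V p.1 x * proj k V p.2 y := by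
  obtain ⟨x, rfl⟩ := AlgQuot.mk_surjective k _ x
  obtain ⟨y, rfl⟩ := AlgQuot.mk_surjective k _ y
  exact projAux_mul n x y

theorem proj_of_mem {n : ℕ} {x : GradedFree k V} (hx : x ∈ gr k V n) : proj k V n x = x := by
  induction hx using Submodule.span_induction with
  | zero => simp
  | add a b _ _ ha hb => rw [map_add, ha, hb]
  | smul r a _ ha => rw [map_smul, ha]
  | mem a ha =>
    obtain ⟨q, rfl, rfl⟩ := ha
    rw [proj_ofMon, if_pos rfl]

end GradedFree

/-! ### The reduced graded pre-Lie algebra `rpL(V)` -/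

/-- `rpL(V)`: the quotient of `pL(V, ∘)` by the ideal generated by `∘ * ∘`. -/
abbrev Reduced : Type (max u v) :=
  AlgQuot k ({GradedFree.dummy k V * GradedFree.dummy k V} : Set (GradedFree k V))

namespace Reduced

open GradedFree

/-- The quotient map `pL(V, ∘) → rpL(V)`. -/
def π : GradedFree k V →ₗ[k] Reduced k V := AlgQuot.mk k _

theorem π_surjective : Function.Surjective (π k V) := AlgQuot.mk_surjective k _

/-- The canonical map `V → rpL(V)`. -/
def ι : V →ₗ[k] Reduced k V := π k V ∘ₗ GradedFree.ι k V

/-- The dummy generator `∘` of `rpL(V)`. -/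
def dummy : Reduced k V := π k V (GradedFree.dummy k V)

/-- The homogeneous component `rpLⁿ(V)`. -/
def gr (n : ℕ) : Submodule k (Reduced k V) := (GradedFree.gr k V n).map (π k V)

variable {k V}

theorem π_mul (x y : GradedFree k V) : π k V (x * y) = π k V x * π k V y := rfl

theorem π_eq_zero {x : GradedFree k V} : π k V x = 0 ↔
    x ∈ idealSpan k ({GradedFree.dummy k V * GradedFree.dummy k V} : Set (GradedFree k V)) :=
  AlgQuot.mk_eq_zero k _

theorem π_associator (x y z : GradedFree k V) :
    π k V (associator x y z) = associator (π k V x) (π k V y) (π k V z) :=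
  AlgQuot.mk_associator k _ x y z

theorem dummy_mul_dummy : dummy k V * dummy k V = 0 :=
  π_eq_zero.2 (subset_idealSpan _ rfl)

/-- The sign automorphism and the differential of `pL(V, ∘)` preserve the ideal `(∘ * ∘)`. -/
theorem ideal_stable (x : GradedFree k V) (hx : π k V x = 0) :
    π k V (sign k V x) = 0 ∧ π k V (dTilde k V x) = 0 := by
  have : idealSpan k ({GradedFree.dummy k V * GradedFree.dummy k V} : Set (GradedFree k V)) ≤
      LinearMap.ker (π k V) ⊓ LinearMap.ker (π k V ∘ₗ (sign k V : GradedFree k V →ₗ[k] GradedFree k V))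
        ⊓ LinearMap.ker (π k V ∘ₗ dTilde k V) := by
    refine idealSpan_le ?_ ?_
    · intro x hx
      obtain rfl : x = _ := hx
      have h0 : π k V (GradedFree.dummy k V) * π k V (GradedFree.dummy k V) = 0 := dummy_mul_dummy
      have hs : sign k V (GradedFree.dummy k V) = (-1 : k) ^ 1 • GradedFree.dummy k V :=
        sign_of_mem dummy_mem
      have hd : dTilde k V (GradedFree.dummy k V) = 0 := dTilde_ofMon _
      refine ⟨⟨?_, ?_⟩, ?_⟩
      · change π k V _ = 0
        rw [π_mul, h0]
      · change π k V (sign k V (GradedFree.dummy k V * GradedFree.dummy k V)) = 0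
        rw [map_mul, hs, π_mul, map_smul, smul_mul_smul_comm, h0, smul_zero]
      · change π k V (dTilde k V _) = 0
        rw [dTilde_mul, hd]
        simp [associator_apply, π_mul, h0]
    · rintro a x ⟨⟨h1, h2⟩, h3⟩
      replace h1 : π k V x = 0 := h1
      replace h2 : π k V (sign k V x) = 0 := h2
      replace h3 : π k V (dTilde k V x) = 0 := h3
      refine ⟨⟨⟨?_, ?_⟩, ?_⟩, ⟨⟨?_, ?_⟩, ?_⟩⟩
      · change π k V _ = 0
        rw [π_mul, h1, mul_zero]
      · change π k V (sign k V _) = 0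
        rw [map_mul, π_mul, h2, mul_zero]
      · change π k V (dTilde k V _) = 0
        rw [dTilde_mul]
        simp [associator_apply, π_mul, h1, h3]
      · change π k V _ = 0
        rw [π_mul, h1, zero_mul]
      · change π k V (sign k V _) = 0
        rw [map_mul, π_mul, h2, zero_mul]
      · change π k V (dTilde k V _) = 0
        rw [dTilde_mul]
        simp [associator_apply, π_mul, h1, h2, h3]
  have h := this (π_eq_zero.1 hx)
  exact ⟨h.1.2, h.2⟩

variable (k V) in
/-- The differential `d` of `rpL(V)`, induced by the differential of `pL(V, ∘)`. -/
def d : Reduced k V →ₗ[k] Reduced k V :=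
  AlgQuot.liftLin k _ (π k V ∘ₗ dTilde k V) fun x hx => (ideal_stable x (π_eq_zero.2 hx)).2

theorem d_π (x : GradedFree k V) : d k V (π k V x) = π k V (dTilde k V x) := rfl

theorem d_ι (v : V) : d k V (ι k V v) = 0 := by
  change π k V (dTilde k V (ofMon k _)) = 0
  rw [dTilde_ofMon]; exact map_zero _

theorem d_dummy : d k V (dummy k V) = 0 := by
  change π k V (dTilde k V (ofMon k _)) = 0
  rw [dTilde_ofMon]; exact map_zero _

/-- `d(a * b) = d(a) * b + (-1) ^ |a| a * d(b) + Φ(∘, a, b)`. -/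
theorem d_mul {n : ℕ} {a : Reduced k V} (ha : a ∈ gr k V n) (b : Reduced k V) :
    d k V (a * b) = d k V a * b + (-1 : k) ^ n • (a * d k V b) + associator (dummy k V) a b := by
  obtain ⟨x, hx, rfl⟩ := ha
  obtain ⟨y, rfl⟩ := π_surjective k V b
  rw [← π_mul, d_π, dTilde_mul, sign_of_mem hx]
  rw [map_add, map_add, π_mul, π_mul, π_associator, map_smul, smul_mul_assoc]
  rfl

theorem d_mem {n : ℕ} {a : Reduced k V} (ha : a ∈ gr k V n) : d k V a ∈ gr k V (n + 1) := by
  obtain ⟨x, hx, rfl⟩ := ha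
  rw [d_π]
  refine Submodule.mem_map_of_mem ?_
  induction hx using Submodule.span_induction with
  | zero => simp
  | add a b _ _ ha hb => rw [map_add]; exact add_mem ha hb
  | smul r a _ ha => rw [map_smul]; exact Submodule.smul_mem _ _ ha
  | mem a ha =>
    obtain ⟨q, rfl, rfl⟩ := ha
    rw [dTilde_ofMon]
    exact dMon_mem q

/-- `d` is the only linear map on `rpL(V)` that vanishes on the generators and satisfies the
product rule. -/
theorem d_unique (e : Reduced k V →ₗ[k] Reduced k V) (h1 : ∀ v, e (ι k V v) = 0)
    (h2 : e (dummy k V) = 0)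
    (h3 : ∀ (n : ℕ), ∀ a ∈ gr k V n, ∀ b, e (a * b) =
      e a * b + (-1 : k) ^ n • (a * e b) + associator (dummy k V) a b) : e = d k V := by
  have key (m : Mon V) : e (π k V (ofMon k m)) = d k V (π k V (ofMon k m)) := by
    induction m using FreeMagma.recOnMul with
    | ih1 g =>
      cases g with
      | none => exact h2.trans d_dummy.symm
      | some v => exact (h1 v).trans (d_ι v).symm
    | ih2 x y hx hy =>
      have hm : π k V (ofMon k x) ∈ gr k V (deg x) := Submodule.mem_map_of_mem (ofMon_mem_gr x)
      rw [ofMon_mul, π_mul, h3 _ _ hm, d_mul hm, hx, hy]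
  ext a
  obtain ⟨x, rfl⟩ := π_surjective k V a
  induction x using induction_mon with
  | h0 => simp
  | hadd x y hx hy => simp only [map_add, hx, hy]
  | hmon r m => simp only [map_smul, key]

/-! ### The identifications `pL(V) = rpL⁰(V)` and `pL¹(V) = rpL¹(V)` -/

/-- A homogeneous element of degree at most one in the ideal `(∘ * ∘)` is zero. -/
theorem eq_zero_of_π {n : ℕ} (hn : n ≤ 1) {x : GradedFree k V} (hx : x ∈ GradedFree.gr k V n)
    (h : π k V x = 0) : x = 0 := by
  have : idealSpan k ({GradedFree.dummy k V * GradedFree.dummy k V} : Set (GradedFree k V)) ≤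
      LinearMap.ker (proj k V 0) ⊓ LinearMap.ker (proj k V 1) := by
    refine idealSpan_le ?_ ?_
    · intro x hx
      obtain rfl : x = _ := hx
      have e : GradedFree.dummy k V * GradedFree.dummy k V =
        ofMon k (.of (none : Option V) * .of none) := (ofMon_mul k V _ _).symm
      constructor
      · change proj k V 0 _ = 0
        rw [e, proj_ofMon]; rfl
      · change proj k V 1 _ = 0
        rw [e, proj_ofMon]; rfl
    · rintro a x ⟨h0, h1⟩
      replace h0 : proj k V 0 x = 0 := h0
      replace h1 : proj k V 1 x = 0 := h1
      have e : Finset.HasAntidiagonal.antidiagonal 1 = {((0 : ℕ), 1), (1, 0)} := rfl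
      refine ⟨⟨?_, ?_⟩, ⟨?_, ?_⟩⟩
      · change proj k V 0 _ = 0
        rw [proj_mul]; simp [h0]
      · change proj k V 1 _ = 0
        rw [proj_mul, e]; simp [h0, h1]
      · change proj k V 0 _ = 0
        rw [proj_mul]; simp [h0]
      · change proj k V 1 _ = 0
        rw [proj_mul, e]; simp [h0, h1]
  have hp := this (π_eq_zero.1 h)
  rw [← proj_of_mem hx]
  obtain rfl | rfl : n = 0 ∨ n = 1 := by omega
  · exact hp.1
  · exact hp.2

variable (k V)

/-- The quotient map restricts to an isomorphism `pL¹(V) ≃ rpL¹(V)`. -/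
def equivOne : GradedFree.gr k V 1 ≃ₗ[k] gr k V 1 :=
  LinearEquiv.ofBijective
    ((π k V).restrict (p := GradedFree.gr k V 1) (q := gr k V 1)
      fun _ hx => Submodule.mem_map_of_mem hx)
    ⟨by
      rw [injective_iff_map_eq_zero]
      intro x hx
      exact Subtype.ext (eq_zero_of_π le_rfl x.2 (congrArg Subtype.val hx)), by
      rintro ⟨_, x, hx, rfl⟩
      exact ⟨⟨x, hx⟩, rfl⟩⟩

/-- The canonical homomorphism from the free nonassociative algebra on `V` to `pL(V, ∘)`. -/
def inclAux : FreeNonUnitalNonAssocAlgebra k V →ₙₐ[k] GradedFree k V :=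
  FreeNonUnitalNonAssocAlgebra.lift k (GradedFree.ι k V)

theorem inclAux_mem (x : FreeNonUnitalNonAssocAlgebra k V) :
    inclAux k V x ∈ GradedFree.gr k V 0 := by
  induction x using MonoidAlgebra.induction_linear with
  | zero => simp
  | add a b ha hb => rw [map_add]; exact add_mem ha hb
  | single m r =>
    have e : (MonoidAlgebra.single m r : FreeNonUnitalNonAssocAlgebra k V) =
      r • MonoidAlgebra.single m 1 := by simp
    rw [e, map_smul]
    refine Submodule.smul_mem _ _ ?_
    clear e
    induction m using FreeMagma.recOnMul with
    | ih1 v =>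
      have : inclAux k V (MonoidAlgebra.single (.of v) 1) = GradedFree.ι k V v :=
        FreeNonUnitalNonAssocAlgebra.lift_of_apply k _ v
      rw [this]
      exact ofMon_mem_gr (k := k) (.of (some v))
    | ih2 x y hx hy =>
      have e : (MonoidAlgebra.single (x * y) 1 : FreeNonUnitalNonAssocAlgebra k V) =
        MonoidAlgebra.single x 1 * MonoidAlgebra.single y 1 := by
        simp [MonoidAlgebra.single_mul_single]
      rw [e, map_mul]
      exact mul_mem_gr (m := 0) (n := 0) hx hy

/-- The canonical homomorphism `pL(V) → pL(V, ∘)`. -/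
def incl : FreePreLie k V →ₙₐ[k] GradedFree k V :=
  AlgQuot.lift k _ (inclAux k V) (by
    have hof (v : V) : inclAux k V (FreeNonUnitalNonAssocAlgebra.of k v) = GradedFree.ι k V v :=
      FreeNonUnitalNonAssocAlgebra.lift_of_apply k _ v
    intro x hx
    cases hx with
    | add v w => simp [hof]
    | smul c v => simp [hof]
    | assoc x y z =>
      have h := assoc_symm (inclAux k V x) (inclAux_mem k V y) (inclAux_mem k V z)
      simp only [mul_zero, pow_zero, one_smul] at h
      simp only [associator_apply, map_sub, map_mul] at h ⊢
      rw [h, sub_self])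

theorem incl_mem (x : FreePreLie k V) : incl k V x ∈ GradedFree.gr k V 0 := by
  obtain ⟨x, rfl⟩ := AlgQuot.mk_surjective k _ x
  exact inclAux_mem k V x

/-- The retraction `pL(V, ∘) → pL(V)` on generators: `v ↦ v` and `∘ ↦ 0`. -/
def retrGen : Option V → FreePreLie k V
  | none => 0
  | some v => FreePreLie.ι k V v

/-- The retraction on the free nonassociative algebra. -/
def retrAux : FreeNonUnitalNonAssocAlgebra k (Option V) →ₙₐ[k] FreePreLie k V :=
  FreeNonUnitalNonAssocAlgebra.lift k (retrGen k V)

theorem retrAux_of (g : Option V) : retrAux k V (mono k (.of g)) = retrGen k V g :=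
  FreeNonUnitalNonAssocAlgebra.lift_of_apply k _ g

theorem retrAux_eq_zero (m : Mon V) (hm : deg m ≠ 0) : retrAux k V (mono k m) = 0 := by
  induction m using FreeMagma.recOnMul with
  | ih1 g =>
    cases g with
    | none => exact retrAux_of k V none
    | some v => exact absurd rfl hm
  | ih2 x y hx hy =>
    rw [mono_mul, map_mul]
    by_cases h : deg x = 0
    · rw [hy (fun h' => hm (by rw [deg_mul, h, h'])), mul_zero]
    · rw [hx h, zero_mul]

/-- The retraction `pL(V, ∘) → pL(V)` that sends `∘` to zero. -/
def retr : GradedFree k V →ₙₐ[k] FreePreLie k V :=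
  AlgQuot.lift k _ (retrAux k V) (by
    intro x hx
    cases hx with
    | add v w => simp [retrAux_of, retrGen]
    | smul c v => simp [retrAux_of, retrGen]
    | assoc x y z =>
      simp only [associator_apply, map_sub, map_smul, map_mul]
      by_cases hy : deg y = 0
      · have h := RightPreLieRing.assoc_symm (retrAux k V (mono k x)) (retrAux k V (mono k y))
          (retrAux k V (mono k z))
        simp only [associator_apply] at h
        rw [h, hy, zero_mul, pow_zero, one_smul, sub_self]
      · simp [retrAux_eq_zero k V y hy])

theorem retr_incl (x : FreePreLie k V) : retr k V (incl k V x) = x := by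
  obtain ⟨x, rfl⟩ := AlgQuot.mk_surjective k _ x
  change retr k V (inclAux k V x) = _
  induction x using MonoidAlgebra.induction_linear with
  | zero => simp
  | add a b ha hb => simp only [map_add, ha, hb]
  | single m r =>
    have e : (MonoidAlgebra.single m r : FreeNonUnitalNonAssocAlgebra k V) =
      r • MonoidAlgebra.single m 1 := by simp
    rw [e]
    simp only [map_smul]
    congr 1
    clear e
    induction m using FreeMagma.recOnMul with
    | ih1 v =>
      have : inclAux k V (MonoidAlgebra.single (.of v) 1) = GradedFree.ι k V v :=
        FreeNonUnitalNonAssocAlgebra.lift_of_apply k _ v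
      rw [this]
      exact retrAux_of k V (some v)
    | ih2 x y hx hy =>
      have e : (MonoidAlgebra.single (x * y) 1 : FreeNonUnitalNonAssocAlgebra k V) =
        MonoidAlgebra.single x 1 * MonoidAlgebra.single y 1 := by
        simp [MonoidAlgebra.single_mul_single]
      rw [e, map_mul, map_mul, hx, hy, AlgQuot.mk_mul]

theorem incl_surjOn {x : GradedFree k V} (hx : x ∈ GradedFree.gr k V 0) :
    ∃ y, incl k V y = x := by
  induction hx using Submodule.span_induction with
  | zero => exact ⟨0, map_zero _⟩
  | add a b _ _ ha hb =>
    obtain ⟨a, rfl⟩ := ha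
    obtain ⟨b, rfl⟩ := hb
    exact ⟨a + b, map_add _ _ _⟩
  | smul r a _ ha =>
    obtain ⟨a, rfl⟩ := ha
    exact ⟨r • a, map_smul _ _ _⟩
  | mem a ha =>
    obtain ⟨m, hm, rfl⟩ := ha
    induction m using FreeMagma.recOnMul with
    | ih1 g =>
      cases g with
      | none => exact absurd hm one_ne_zero
      | some v =>
        exact ⟨FreePreLie.ι k V v, FreeNonUnitalNonAssocAlgebra.lift_of_apply k _ v⟩
    | ih2 x y hx hy =>
      rw [deg_mul, Nat.add_eq_zero_iff] at hm
      obtain ⟨a, ha⟩ := hx hm.1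
      obtain ⟨b, hb⟩ := hy hm.2
      exact ⟨a * b, by rw [map_mul, ha, hb, ofMon_mul]⟩

/-- The canonical isomorphism `pL(V) ≃ rpL⁰(V)`, which is the identity on `V`. -/
def equivZero : FreePreLie k V ≃ₗ[k] gr k V 0 :=
  LinearEquiv.ofBijective
    ((π k V ∘ₗ (incl k V : FreePreLie k V →ₗ[k] GradedFree k V)).codRestrict (gr k V 0)
      fun x => Submodule.mem_map_of_mem (incl_mem k V x))
    ⟨by
      rw [injective_iff_map_eq_zero]
      intro x hx
      have h := eq_zero_of_π zero_le_one (incl_mem k V x) (congrArg Subtype.val hx)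
      rw [← retr_incl k V x, h, map_zero], by
      rintro ⟨_, x, hx, rfl⟩
      obtain ⟨y, rfl⟩ := incl_surjOn k V hx
      exact ⟨y, rfl⟩⟩

end Reduced

/-- The map `d : pL(V) → pL¹(V)`: the component `rpL⁰(V) → rpL¹(V)` of the differential of
`rpL(V)`, under the identifications `pL(V) = rpL⁰(V)` and `pL¹(V) = rpL¹(V)`. -/
def d : FreePreLie k V →ₗ[k] GradedFree.gr k V 1 :=
  (Reduced.equivOne k V).symm.toLinearMap
    ∘ₗ (Reduced.d k V).restrict (p := Reduced.gr k V 0) (q := Reduced.gr k V 1)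
      (fun _ hx => Reduced.d_mem hx)
    ∘ₗ (Reduced.equivZero k V).toLinearMap

end PreLie

end

/-! That L(V) lies in the kernel is formal: d kills V, and the kernel is closed under the bracket
because Φ(∘, a, b) is symmetric in a and b of degree zero (`d_lie`).

For the converse, d is tested against representations. Let ρ be a representation on M of the Lie
algebra pL(V)_L, and let m in M be annihilated by V. The representation axiom is what makes pL(V) ⊕
M a pre-Lie algebra under (a, p) * (b, q) = (a * b, -ρ b p) (`SquareZero.associator_symm`). Placing
M in degree one makes it graded pre-Lie, so there is a homomorphism from pL(V, ∘) that is the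
identity on V and sends ∘ to m (`SquareZero.hom`). It sends d x to an element whose M-component is ρ
x m (`SquareZero.snd_hom_dTilde`). Hence d x = 0 forces x to annihilate m.

It remains to choose M and m so that the annihilator of m is exactly L(V). For any Lie subalgebra L
of a Lie algebra g over a field, the module induced from the trivial representation of L, with its
generator, has this property (`exists_annihilator_eq`). Instead of passing through the enveloping
algebra, the module is built directly on the symmetric algebra of a complement C of L, whose
monomials are multisets of basis indices, by the recursion of the classical proof of
Poincaré-Birkhoff-Witt. The basis of g is indexed by J (for C) followed by K (for L). The module
axiom is `defect_eq_zero`; by `act_zero_apply`, the linear part of x · 1 is the C-component of x, so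
only L kills 1. -/

noncomputable section

/-! ### Multisets filtered by size, and operators with prescribed leading term. -/

namespace LieSubalgebra

namespace AnnModule

open Finsupp Module

variable {k g J K : Type*} [Field k] [LieRing g] [LieAlgebra k g]

variable (k J) in
/-- The combinations of multisets with at most `n` elements. -/
def fil (n : ℕ) : Submodule k (Multiset J →₀ k) := supported k k {s | s.card ≤ n}

theorem single_mem_fil {s : Multiset J} {n : ℕ} (h : s.card ≤ n) : single s (1 : k) ∈ fil k J n :=
  single_mem_supported k 1 h

theorem fil_mono {m n : ℕ} (h : m ≤ n) : fil k J m ≤ fil k J n :=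
  supported_mono fun _ hs => le_trans hs h

/-- A property of combinations in `fil k J n` that holds for multisets and is linear. -/
theorem fil_le_ker {N : Type*} [AddCommGroup N] [Module k N] {P : Submodule k N} {n : ℕ}
    {f : (Multiset J →₀ k) →ₗ[k] N} (h : ∀ s : Multiset J, s.card ≤ n → f (single s 1) ∈ P)
    {u : Multiset J →₀ k} (hu : u ∈ fil k J n) : f u ∈ P := by
  rw [fil, supported_eq_span_single] at hu
  have : Submodule.span k ((fun i => single i (1 : k)) '' {s : Multiset J | s.card ≤ n}) ≤
      P.comap f := by
    rw [Submodule.span_le]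
    rintro _ ⟨s, hs, rfl⟩
    exact h s hs
  exact this hu

variable (b : Basis (J ⊕ K) k g)

/-- A linear property of `g` that holds for basis vectors. -/
theorem basis_mem {N : Type*} [AddCommGroup N] [Module k N] {P : Submodule k N} {f : g →ₗ[k] N}
    (h : ∀ i, f (b i) ∈ P) (x : g) : f x ∈ P := by
  have : Submodule.span k (Set.range b) ≤ P.comap f := by
    rw [Submodule.span_le]
    rintro _ ⟨i, rfl⟩
    exact h i
  exact this (b.span_eq ▸ Submodule.mem_top)

/-- Bilinear extension from basis vectors and multisets. -/
def extend (f : J ⊕ K → Multiset J → (Multiset J →₀ k)) :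
    g →ₗ[k] (Multiset J →₀ k) →ₗ[k] (Multiset J →₀ k) :=
  b.constr k fun i => linearCombination k (f i)

theorem extend_apply (f : J ⊕ K → Multiset J → (Multiset J →₀ k)) (i : J ⊕ K) (s : Multiset J) :
    extend b f (b i) (single s 1) = f i s := by
  simp [extend]

/-- Bilinear maps that agree on basis vectors and on multisets with at most `n` elements agree on
`fil k J n`. -/
theorem eq_of_mem_fil {R R' : g →ₗ[k] (Multiset J →₀ k) →ₗ[k] (Multiset J →₀ k)} {n : ℕ}
    (h : ∀ i, ∀ s : Multiset J, s.card ≤ n → R (b i) (single s 1) = R' (b i) (single s 1)) (x : g)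
    {u : Multiset J →₀ k} (hu : u ∈ fil k J n) : R x u = R' x u := by
  have hx : ∀ s : Multiset J, s.card ≤ n → R x (single s 1) = R' x (single s 1) := by
    intro s hs
    have : R.flip (single s 1) = R'.flip (single s 1) := b.ext fun i => h i s hs
    exact LinearMap.congr_fun this x
  rw [← sub_eq_zero, ← Submodule.mem_bot k]
  exact fil_le_ker (f := R x - R' x) (fun s hs => (Submodule.mem_bot k).2
    (sub_eq_zero.2 (hx s hs))) hu

/-- The leading term of the action of a basis vector on a multiset. -/
def ins (k : Type*) [Field k] : J ⊕ K → Multiset J → (Multiset J →₀ k)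
  | .inl j, s => single (j ::ₘ s) 1
  -- Elements of L kill the empty multiset, and on the other multisets they produce no term of
  -- higher order.
  | .inr _, _ => 0

theorem ins_mem_fil (i : J ⊕ K) (s : Multiset J) : ins k i s ∈ fil k J (s.card + 1) := by
  cases i with
  | inl j => exact single_mem_fil (by simp)
  | inr _ => exact zero_mem _

/-- If the action agrees with `ins` up to terms of lower order, it raises the order by at most
one. -/
theorem mem_fil_succ {R : g →ₗ[k] (Multiset J →₀ k) →ₗ[k] (Multiset J →₀ k)}
    (hR : ∀ i s, R (b i) (single s 1) - ins k i s ∈ fil k J s.card) (x : g) {n : ℕ}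
    {u : Multiset J →₀ k} (hu : u ∈ fil k J n) : R x u ∈ fil k J (n + 1) := by
  refine fil_le_ker (fun s hs => ?_) hu
  refine basis_mem b (f := R.flip (single s 1)) (fun i => ?_) x
  rw [LinearMap.flip_apply, ← sub_add_cancel (R (b i) (single s 1)) (ins k i s)]
  exact add_mem (fil_mono (by omega) (hR i s)) (fil_mono (by omega) (ins_mem_fil i s))

/-! ### The action of g on multisets, by recursion on size. -/

variable [LinearOrder J]

/-- The index `i` comes strictly after `j`, where the indices in `K` come after those in `J`. -/
def Above (j : J) : J ⊕ K → Prop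
  | .inl i => j < i
  -- Factors from L are always moved to the right, towards the empty multiset, which they kill.
  | .inr _ => True

/-- `s` is obtained from `t` by adding the minimal element `j`, and `i` comes after `j`. -/
def Splits (i : J ⊕ K) (s : Multiset J) (p : J × Multiset J) : Prop :=
  s = p.1 ::ₘ p.2 ∧ (∀ a ∈ p.2, p.1 ≤ a) ∧ Above p.1 i

/-- The removed element is the minimum of `s`, hence determined by `s`. So the choice made in `step`
is immaterial. -/
theorem Splits.unique {i : J ⊕ K} {s : Multiset J} {p q : J × Multiset J} (hp : Splits i s p)
    (hq : Splits i s q) : p = q := by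
  obtain ⟨j, t⟩ := p
  obtain ⟨j', t'⟩ := q
  obtain ⟨h1, h2, -⟩ := hp
  obtain ⟨h1', h2', -⟩ := hq
  dsimp only at *
  have key : ∀ {x y : J} {u w : Multiset J}, x ::ₘ u = y ::ₘ w → (∀ a ∈ u, x ≤ a) → x ≤ y := by
    intro x y u w h hu
    have : y ∈ x ::ₘ u := h ▸ Multiset.mem_cons_self y w
    rcases Multiset.mem_cons.1 this with rfl | h'
    exacts [le_rfl, hu _ h']
  have e : j = j' := le_antisymm (key (h1.symm.trans h1') h2) (key (h1'.symm.trans h1) h2')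
  subst e
  rw [(Multiset.cons_inj_right j).1 (h1.symm.trans h1')]

open Classical in
/-- The recursion step that defines the action on multisets. -/
def step (R : g →ₗ[k] (Multiset J →₀ k) →ₗ[k] (Multiset J →₀ k)) (i : J ⊕ K) (s : Multiset J) :
    Multiset J →₀ k :=
  ins k i s + if h : ∃ p, Splits i s p then
    -- With s = j · t this imposes x_i x_j t = x_j x_i t + [x_i, x_j] t. In x_j x_i t the leading
    -- term of x_i t has already contributed `ins k i s`, so only the lower-order remainder is
    -- passed to the recursion.
    R (b (.inl h.choose.1)) (R (b i) (single h.choose.2 1) - ins k i h.choose.2)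
      + R ⁅b i, b (.inl h.choose.1)⁆ (single h.choose.2 1)
  else 0

theorem step_of_splits (R : g →ₗ[k] (Multiset J →₀ k) →ₗ[k] (Multiset J →₀ k)) {i : J ⊕ K}
    {s : Multiset J} {p : J × Multiset J} (hp : Splits i s p) :
    step b R i s = ins k i s + (R (b (.inl p.1)) (R (b i) (single p.2 1) - ins k i p.2)
      + R ⁅b i, b (.inl p.1)⁆ (single p.2 1)) := by
  have h : ∃ p, Splits i s p := ⟨p, hp⟩
  rw [step, dif_pos h, h.choose_spec.unique hp]

theorem step_of_not_splits (R : g →ₗ[k] (Multiset J →₀ k) →ₗ[k] (Multiset J →₀ k)) {i : J ⊕ K}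
    {s : Multiset J} (h : ¬ ∃ p, Splits i s p) : step b R i s = ins k i s := by
  rw [step, dif_neg h, add_zero]

/-- Successive approximations of the action; the `n`-th one is correct on multisets with at
most `n` elements. -/
def approx : ℕ → g →ₗ[k] (Multiset J →₀ k) →ₗ[k] (Multiset J →₀ k)
  | 0 => extend b (ins k)
  | n + 1 => extend b (step b (approx n))

/-- The corrections in `step` come from a multiset with one element fewer, or from terms of at most
that order, and one further operator raises the order by at most one (`mem_fil_succ`). So they never
exceed the order of `s`. -/
theorem approx_sub_ins (n : ℕ) (i : J ⊕ K) (s : Multiset J) :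
    approx b n (b i) (single s 1) - ins k i s ∈ fil k J s.card := by
  induction n generalizing i s with
  | zero => rw [approx, extend_apply, sub_self]; exact zero_mem _
  | succ n ih =>
    rw [approx, extend_apply]
    by_cases h : ∃ p, Splits i s p
    · obtain ⟨⟨j, t⟩, hp⟩ := h
      have hc : s.card = t.card + 1 := by rw [hp.1, Multiset.card_cons]
      rw [step_of_splits b _ hp, add_sub_cancel_left, hc]
      exact add_mem (mem_fil_succ b ih _ (ih i t)) (mem_fil_succ b ih _ (single_mem_fil le_rfl))
    · rw [step_of_not_splits b _ h, sub_self]; exact zero_mem _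

/-- The empty multiset does not split, so the recursion starts correctly. On at most n + 1 elements,
`step` evaluates the previous level only on `fil k J n`, where it is already stable by induction. -/
theorem approx_succ (n : ℕ) (x : g) {u : Multiset J →₀ k} (hu : u ∈ fil k J n) :
    approx b (n + 1) x u = approx b n x u := by
  induction n generalizing x u with
  | zero =>
    refine eq_of_mem_fil b (fun i s hs => ?_) x hu
    rw [approx, extend_apply, approx, extend_apply, step_of_not_splits]
    rintro ⟨p, hp⟩
    rw [hp.1, Multiset.card_cons] at hs
    omega
  | succ n ih =>
    refine eq_of_mem_fil b (fun i s hs => ?_) x hu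
    rw [approx, extend_apply]
    conv_rhs => rw [approx, extend_apply]
    by_cases h : ∃ p, Splits i s p
    · obtain ⟨⟨j, t⟩, hp⟩ := h
      have hc : t.card ≤ n := by
        have := hp.1 ▸ hs
        rwa [Multiset.card_cons, Nat.add_le_add_iff_right] at this
      have ht := single_mem_fil (k := k) hc
      rw [step_of_splits b _ hp, step_of_splits b _ hp, ih _ ht, ih _ ht,
        ih _ (fil_mono hc (approx_sub_ins b n i t))]
    · rw [step_of_not_splits b _ h, step_of_not_splits b _ h]

/-- The action of `g` on combinations of multisets. -/
def act : g →ₗ[k] (Multiset J →₀ k) →ₗ[k] (Multiset J →₀ k) :=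
  extend b fun i s => approx b s.card (b i) (single s 1)

theorem approx_of_le {m n : ℕ} (h : m ≤ n) (x : g) {u : Multiset J →₀ k} (hu : u ∈ fil k J m) :
    approx b n x u = approx b m x u := by
  induction n, h using Nat.le_induction with
  | base => rfl
  | succ n hn ih => rw [approx_succ b n x (fil_mono hn hu), ih]

theorem act_eq_approx (n : ℕ) (x : g) {u : Multiset J →₀ k} (hu : u ∈ fil k J n) :
    act b x u = approx b n x u := by
  refine eq_of_mem_fil b (fun i s hs => ?_) x hu
  rw [act, extend_apply, approx_of_le b hs _ (single_mem_fil le_rfl)]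

theorem act_sub_ins (i : J ⊕ K) (s : Multiset J) :
    act b (b i) (single s 1) - ins k i s ∈ fil k J s.card := by
  rw [act_eq_approx b _ _ (single_mem_fil le_rfl)]
  exact approx_sub_ins b _ i s

theorem act_of_not_splits {i : J ⊕ K} {s : Multiset J} (h : ¬ ∃ p, Splits i s p) :
    act b (b i) (single s 1) = ins k i s := by
  -- A positive level is taken so that the approximation unfolds to `step`, even for the empty
  -- multiset.
  rw [act_eq_approx b (s.card + 1) _ (single_mem_fil (by omega)), approx, extend_apply,
    step_of_not_splits b _ h]

theorem act_zero (i : J ⊕ K) : act b (b i) (single 0 1) = ins k i 0 :=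
  act_of_not_splits b fun ⟨_, hp⟩ => Multiset.cons_ne_zero hp.1.symm

theorem act_of_le {j : J} {s : Multiset J} (h : ∀ a ∈ s, j ≤ a) :
    act b (b (.inl j)) (single s 1) = single (j ::ₘ s) 1 := by
  refine act_of_not_splits b ?_
  rintro ⟨⟨a, t⟩, hp⟩
  have : a ∈ s := by rw [hp.1]; exact Multiset.mem_cons_self a t
  exact absurd (hp.2.2 : a < j) (not_lt.2 (h a this))

/-- The index `j` stays minimal after `i` is inserted, so acting by it is plain insertion. This is
the leading part that `step` treats separately. -/
theorem act_ins {i : J ⊕ K} {j : J} {t : Multiset J} (ht : ∀ a ∈ t, j ≤ a) (hi : Above j i) :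
    act b (b (.inl j)) (ins k i t) = ins k i (j ::ₘ t) := by
  cases i with
  | inl a =>
    have h : ∀ c ∈ a ::ₘ t, j ≤ c := by
      intro c hc
      rcases Multiset.mem_cons.1 hc with rfl | hc
      exacts [le_of_lt hi, ht c hc]
    rw [ins, ins, act_of_le b h, Multiset.cons_swap]
  | inr _ => exact map_zero _

/-- The recursion for the limit action: `act_ins` restores the leading term split off in `step`.
This is the instance of the module axiom that holds by construction. -/
theorem act_cons {i : J ⊕ K} {j : J} {t : Multiset J} (ht : ∀ a ∈ t, j ≤ a) (hi : Above j i) :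
    act b (b i) (single (j ::ₘ t) 1) = act b (b (.inl j)) (act b (b i) (single t 1))
      + act b ⁅b i, b (.inl j)⁆ (single t 1) := by
  have ht0 := single_mem_fil (k := k) (le_refl t.card)
  rw [act_eq_approx b (t.card + 1) _ (single_mem_fil (by simp)), approx, extend_apply,
    step_of_splits b _ (p := (j, t)) ⟨rfl, ht, hi⟩, ← act_ins b ht hi,
    ← act_eq_approx b _ _ ht0, ← act_eq_approx b _ _ ht0,
    ← act_eq_approx b _ _ (act_sub_ins b i t), map_sub]
  abel

/-! ### The module axiom. -/

/-- The defect of the module axiom. -/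
def defect : g →ₗ[k] g →ₗ[k] (Multiset J →₀ k) →ₗ[k] (Multiset J →₀ k) :=
  LinearMap.mk₂ k (fun x y => act b x ∘ₗ act b y - act b y ∘ₗ act b x - act b ⁅x, y⁆)
    (fun x x' y => by
      simp only [map_add, add_lie, LinearMap.add_comp, LinearMap.comp_add]; abel)
    (fun c x y => by
      simp only [map_smul, smul_lie, LinearMap.smul_comp, LinearMap.comp_smul]; module)
    (fun x y y' => by
      simp only [map_add, lie_add, LinearMap.add_comp, LinearMap.comp_add]; abel)
    (fun c x y => by
      simp only [map_smul, lie_smul, LinearMap.smul_comp, LinearMap.comp_smul]; module)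

theorem defect_apply (x y : g) (u : Multiset J →₀ k) :
    defect b x y u = act b x (act b y u) - act b y (act b x u) - act b ⁅x, y⁆ u := rfl

theorem defect_swap (x y : g) (u : Multiset J →₀ k) : defect b x y u = -defect b y x u := by
  rw [defect_apply, defect_apply, ← lie_skew x y, map_neg, LinearMap.neg_apply]; abel

theorem defect_of_le {i : J ⊕ K} {j : J} {s : Multiset J} (hs : ∀ a ∈ s, j ≤ a)
    (hi : Above j i) : defect b (b i) (b (.inl j)) (single s 1) = 0 := by
  rw [defect_apply, act_of_le b hs, act_cons b hs hi]; abel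

/-- If `i` comes before `j`, then `i` is itself minimal for `s`, and antisymmetry of the defect
exchanges the roles. -/
theorem defect_of_min {j : J} {s : Multiset J} (hs : ∀ a ∈ s, j ≤ a) (i : J ⊕ K) :
    defect b (b i) (b (.inl j)) (single s 1) = 0 := by
  cases i with
  | inr _ => exact defect_of_le b hs trivial
  | inl a =>
    rcases lt_trichotomy j a with h | rfl | h
    · exact defect_of_le b hs h
    · rw [defect_apply, lie_self]; simp
    · rw [defect_swap, defect_of_le (i := .inl j) b (fun c hc => h.le.trans (hs c hc)) h, neg_zero]

theorem above_or_le (j : J) (i : J ⊕ K) : Above j i ∨ ∃ a, i = .inl a ∧ a ≤ j := by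
  cases i with
  | inr _ => exact .inl trivial
  | inl a => exact (lt_or_ge j a).imp id fun h => ⟨a, rfl, h⟩

theorem exists_min {s : Multiset J} (hs : s ≠ 0) : ∃ j t, s = j ::ₘ t ∧ ∀ a ∈ t, j ≤ a := by
  classical
  have hne : s.toFinset.Nonempty := by
    obtain ⟨a, ha⟩ := Multiset.exists_mem_of_ne_zero hs
    exact ⟨a, Multiset.mem_toFinset.2 ha⟩
  have hm : s.toFinset.min' hne ∈ s := Multiset.mem_toFinset.1 (s.toFinset.min'_mem hne)
  exact ⟨_, _, (Multiset.cons_erase hm).symm, fun a ha =>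
    s.toFinset.min'_le a (Multiset.mem_toFinset.2 (Multiset.mem_of_mem_erase ha))⟩

theorem act_zero_of_mem_span {x : g} (hx : x ∈ Submodule.span k (Set.range (b ∘ Sum.inr))) :
    act b x (single 0 1) = 0 := by
  have : Submodule.span k (Set.range (b ∘ Sum.inr)) ≤
      LinearMap.ker ((act b).flip (single 0 1)) := by
    rw [Submodule.span_le]
    rintro _ ⟨κ, rfl⟩
    exact act_zero b (.inr κ)
  exact this hx

/-- The induction step, where the minimum `m` of the multiset comes before both indices. -/
theorem defect_cons {m : J} {t : Multiset J} (ht : ∀ a ∈ t, m ≤ a) {i j : J ⊕ K}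
    (hi : Above m i) (hj : Above m j) (ih : ∀ x y, ∀ u ∈ fil k J t.card, defect b x y u = 0) :
    defect b (b i) (b j) (single (m ::ₘ t) 1) = 0 := by
  -- Split x_q t into its leading term and a remainder. The remainder falls under the induction
  -- hypothesis; the leading term is zero or a multiset that still has `m` as a lower bound.
  have key : ∀ {p q : J ⊕ K}, Above m p → Above m q →
      defect b (b p) (b (.inl m)) (act b (b q) (single t 1)) = 0 := by
    intro p q hp hq
    rw [← sub_add_cancel (act b (b q) (single t 1)) (ins k q t), map_add,
      ih _ _ _ (act_sub_ins b q t), zero_add]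
    cases q with
    | inr _ => exact map_zero _
    | inl a =>
      refine defect_of_le b (fun c hc => ?_) hp
      rcases Multiset.mem_cons.1 hc with rfl | hc
      exacts [le_of_lt hq, ht c hc]
  have ht0 := single_mem_fil (k := k) (le_refl t.card)
  have e1 := key hi hj
  have e2 := key hj hi
  have e3 := ih (b i) ⁅b j, b (.inl m)⁆ _ ht0
  have e4 := ih (b j) ⁅b i, b (.inl m)⁆ _ ht0
  have e5 := ih (b i) (b j) _ ht0
  have e6 := ih ⁅b i, b j⁆ (b (.inl m)) _ ht0
  have e7 := congrArg (act b (b (.inl m))) e5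
  have jac : act b ⁅⁅b i, b j⁆, b (.inl m)⁆ (single t 1) =
      act b ⁅b i, ⁅b j, b (.inl m)⁆⁆ (single t 1)
        - act b ⁅b j, ⁅b i, b (.inl m)⁆⁆ (single t 1) := by
    rw [lie_lie, map_sub, LinearMap.sub_apply]
  rw [defect_apply, act_cons b ht hi, act_cons b ht hj, ← act_of_le b ht]
  simp only [defect_apply, map_add, map_sub, map_zero] at e1 e2 e3 e4 e6 e7 ⊢
  rw [jac] at e6
  -- Write m · t as x_m t and move x_m to the left past every operator. The double brackets cancel
  -- by Jacobi, and what remains is x_m applied to the defect on t.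
  linear_combination (norm := module) e1 - e2 + e3 - e4 + e7 - e6

/-- Induction on the size of the multiset. That L is closed under the bracket enters only on the
empty multiset, for two indices in `K`: both vectors kill it, so their bracket must too. -/
theorem defect_eq_zero
    (hL : ∀ κ κ' : K, ⁅b (.inr κ), b (.inr κ')⁆ ∈ Submodule.span k (Set.range (b ∘ Sum.inr)))
    (x y : g) (u : Multiset J →₀ k) : defect b x y u = 0 := by
  have ext (n : ℕ) (h : ∀ i j, ∀ s : Multiset J, s.card ≤ n → defect b (b i) (b j) (single s 1) = 0)
      (x y : g) (u : Multiset J →₀ k) (hu : u ∈ fil k J n) : defect b x y u = 0 := by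
    refine eq_of_mem_fil b (R := defect b x) (R' := 0) (fun j s hs => ?_) y hu
    have : ((defect b).flip (b j)).flip (single s 1) = 0 := b.ext fun i => h i j s hs
    exact LinearMap.congr_fun this x
  have nil (i j : J ⊕ K) : defect b (b i) (b j) (single 0 1) = 0 := by
    cases j with
    | inl j => exact defect_of_min b (by simp) i
    | inr κ =>
      cases i with
      | inl i => rw [defect_swap, defect_of_min b (by simp), neg_zero]
      | inr κ' =>
        rw [defect_apply, act_zero, act_zero, act_zero_of_mem_span b (hL _ _)]
        simp [ins]
  have main (n : ℕ) : ∀ x y : g, ∀ u ∈ fil k J n, defect b x y u = 0 := by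
    induction n with
    | zero =>
      refine ext 0 fun i j s hs => ?_
      obtain rfl := Multiset.card_eq_zero.1 (Nat.le_zero.1 hs)
      exact nil i j
    | succ n ih =>
      refine ext (n + 1) fun i j s hs => ?_
      rcases eq_or_ne s 0 with rfl | h0
      · exact nil i j
      obtain ⟨m, t, rfl, ht⟩ := exists_min h0
      have hle {a : J} (ha : a ≤ m) : ∀ c ∈ m ::ₘ t, a ≤ c := by
        intro c hc
        rcases Multiset.mem_cons.1 hc with rfl | hc
        exacts [ha, ha.trans (ht c hc)]
      rcases above_or_le m j with hj | ⟨a, rfl, ha⟩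
      · rcases above_or_le m i with hi | ⟨a, rfl, ha⟩
        · rw [Multiset.card_cons] at hs
          exact defect_cons b ht hi hj fun x y u hu => ih x y u (fil_mono (by omega) hu)
        · rw [defect_swap, defect_of_min b (hle ha), neg_zero]
      · exact defect_of_min b (hle ha) i
  exact main (u.support.sup Multiset.card) x y u fun s hs => Finset.le_sup (f := Multiset.card) hs

/-! ### The annihilator of the empty multiset. -/

theorem act_zero_apply (x : g) (j : J) : act b x (single 0 1) {j} = b.repr x (.inl j) := by
  have : lapply {j} ∘ₗ (act b).flip (single 0 1) = b.coord (.inl j) := by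
    refine b.ext fun i => ?_
    rw [LinearMap.comp_apply, LinearMap.flip_apply, act_zero, b.coord_apply, b.repr_self]
    cases i with
    | inl a => classical simp [ins, single_apply]
    | inr _ => simp [ins]
  exact LinearMap.congr_fun this x

end AnnModule

open AnnModule Module in
/-- Every Lie subalgebra is the annihilator of a vector in some representation (a consequence of
the Poincaré-Birkhoff-Witt theorem). -/
theorem exists_annihilator_eq {k : Type u} {g : Type v} [Field k] [LieRing g] [LieAlgebra k g]
    (L : LieSubalgebra k g) : ∃ (M : Type (max u v)) (_ : AddCommGroup M) (_ : Module k M)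
      (ρ : g →ₗ[k] M →ₗ[k] M) (m : M),
      (∀ x y n, ρ ⁅x, y⁆ n = ρ x (ρ y n) - ρ y (ρ x n)) ∧ ∀ x, ρ x m = 0 ↔ x ∈ L := by
  classical
  obtain ⟨C, hC⟩ := Submodule.exists_isCompl L.toSubmodule
  let bC := Basis.ofVectorSpace k C
  let bL := Basis.ofVectorSpace k L.toSubmodule
  let b := (bC.prod bL).map (Submodule.prodEquivOfIsCompl C L.toSubmodule hC.symm)
  -- Any linear order would do: only minima of finite multisets are used.
  let : LinearOrder (Basis.ofVectorSpaceIndex k C) := linearOrderOfSTO WellOrderingRel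
  have hr (κ) : b (.inr κ) = bL κ := by simp [b]
  have hmem (κ) : b (.inr κ) ∈ L := by rw [hr]; exact (bL κ).2
  have hspan : Submodule.span k (Set.range (b ∘ Sum.inr)) = L.toSubmodule := by
    have e : b ∘ Sum.inr = L.toSubmodule.subtype ∘ bL := funext hr
    rw [e, Set.range_comp, Submodule.span_image, bL.span_eq, Submodule.map_top,
      Submodule.range_subtype]
  have hdef := defect_eq_zero b fun κ κ' => by
    rw [hspan]; exact L.lie_mem (hmem κ) (hmem κ')
  refine ⟨Multiset (Basis.ofVectorSpaceIndex k C) →₀ k, inferInstance, inferInstance,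
    act b, Finsupp.single 0 1, fun x y u => (sub_eq_zero.1 (hdef x y u)).symm,
    fun x => ⟨fun h => ?_, fun h => act_zero_of_mem_span b (by rwa [hspan])⟩⟩
  rw [← LieSubalgebra.mem_toSubmodule, ← hspan, ← b.linearCombination_repr x,
    Finsupp.linearCombination_apply]
  refine Submodule.sum_mem _ fun i _ => ?_
  cases i with
  | inl j =>
    have : b.repr x (.inl j) = 0 := by
      rw [← act_zero_apply b x j]
      exact DFunLike.congr_fun h {j}
    dsimp only
    rw [this, zero_smul]
    exact zero_mem _
  | inr κ => exact Submodule.smul_mem _ _ (Submodule.subset_span ⟨κ, rfl⟩)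

end LieSubalgebra

end

/-! ### Lie elements lie in the kernel of d. -/

noncomputable section

namespace PreLie

variable {k : Type u} [CommRing k] {V : Type v} [AddCommGroup V] [Module k V]

theorem FreePreLie.induction {p : FreePreLie k V → Prop} (hι : ∀ v, p (FreePreLie.ι k V v))
    (hadd : ∀ x y, p x → p y → p (x + y)) (hsmul : ∀ (r : k) x, p x → p (r • x))
    (hmul : ∀ x y, p x → p y → p (x * y)) (x : FreePreLie k V) : p x := by
  obtain ⟨x, rfl⟩ := AlgQuot.mk_surjective k _ x
  induction x using MonoidAlgebra.induction_linear with
  | zero => simpa using hsmul 0 _ (hι 0)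
  | add a b ha hb => rw [map_add]; exact hadd _ _ ha hb
  | single m r =>
    have e : (MonoidAlgebra.single m r : FreeNonUnitalNonAssocAlgebra k V) =
      r • MonoidAlgebra.single m 1 := by simp
    rw [e, map_smul]
    refine hsmul _ _ ?_
    clear e
    induction m using FreeMagma.recOnMul with
    | ih1 v => exact hι v
    | ih2 x y hx hy =>
      have e : (MonoidAlgebra.single (x * y) 1 : FreeNonUnitalNonAssocAlgebra k V) =
        MonoidAlgebra.single x 1 * MonoidAlgebra.single y 1 := by
        simp [MonoidAlgebra.single_mul_single]
      rw [e, AlgQuot.mk_mul]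
      exact hmul _ _ hx hy

theorem incl_ι (v : V) : Reduced.incl k V (FreePreLie.ι k V v) = GradedFree.ι k V v :=
  FreeNonUnitalNonAssocAlgebra.lift_of_apply k _ v

/-- The differential of `pL(V)` is the restriction of the differential of `pL(V, ∘)`. -/
theorem d_eq_zero_iff (x : FreePreLie k V) :
    d k V x = 0 ↔ GradedFree.dTilde k V (Reduced.incl k V x) = 0 := by
  have hmem : GradedFree.dTilde k V (Reduced.incl k V x) ∈ GradedFree.gr k V 1 := by
    have hx := Reduced.incl_mem k V x
    generalize Reduced.incl k V x = y at hx
    induction hx using Submodule.span_induction with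
    | zero => simp
    | add a b _ _ ha hb => rw [map_add]; exact add_mem ha hb
    | smul r a _ ha => rw [map_smul]; exact Submodule.smul_mem _ _ ha
    | mem a ha =>
      obtain ⟨q, hq, rfl⟩ := ha
      rw [GradedFree.dTilde_ofMon]
      simpa [hq] using GradedFree.dMon_mem (k := k) q
  rw [d, LinearMap.comp_apply, LinearEquiv.coe_coe, LinearEquiv.map_eq_zero_iff, ← Subtype.val_inj]
  change Reduced.π k V (GradedFree.dTilde k V (Reduced.incl k V x)) = 0 ↔ _
  -- The ideal (∘ * ∘) has no nonzero element of degree one, so vanishing can be tested before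
  -- passing to the quotient.
  exact ⟨Reduced.eq_zero_of_π le_rfl hmem, fun h => by rw [h, map_zero]⟩

theorem dTilde_incl_mul (x y : FreePreLie k V) :
    GradedFree.dTilde k V (Reduced.incl k V (x * y)) =
      GradedFree.dTilde k V (Reduced.incl k V x) * Reduced.incl k V y
        + Reduced.incl k V x * GradedFree.dTilde k V (Reduced.incl k V y)
        + associator (GradedFree.dummy k V) (Reduced.incl k V x) (Reduced.incl k V y) := by
  rw [map_mul, GradedFree.dTilde_mul, GradedFree.sign_of_mem (Reduced.incl_mem k V x), pow_zero,
    one_smul]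

theorem d_ι (v : V) : d k V (FreePreLie.ι k V v) = 0 := by
  rw [d_eq_zero_iff, incl_ι]
  exact GradedFree.dTilde_ofMon _

/-- The derivation terms vanish, and Φ(∘, x, y) - Φ(∘, y, x) = 0 since the sign is trivial in degree
zero. -/
theorem d_lie {x y : FreePreLie k V} (hx : d k V x = 0) (hy : d k V y = 0) : d k V ⁅x, y⁆ = 0 := by
  rw [d_eq_zero_iff] at *
  have e : ⁅x, y⁆ = x * y - y * x := rfl
  have h := GradedFree.assoc_symm (GradedFree.dummy k V) (Reduced.incl_mem k V x)
    (Reduced.incl_mem k V y)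
  rw [mul_zero, pow_zero, one_smul] at h
  rw [e, map_sub, map_sub, dTilde_incl_mul, dTilde_incl_mul, hx, hy, h]
  simp

theorem lieElements_le_ker_d : (lieElements k V).toSubmodule ≤ LinearMap.ker (d k V) := by
  let K : LieSubalgebra k (FreePreLie k V) :=
    { LinearMap.ker (d k V) with lie_mem' := fun hx hy => d_lie hx hy }
  have : lieElements k V ≤ K := LieSubalgebra.lieSpan_le.2 (by
    rintro _ ⟨v, rfl⟩
    exact d_ι v)
  exact this

/-! ### Square-zero extensions of `pL(V)` -/

section SquareZero

variable {M : Type*} [AddCommGroup M] [Module k M]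

/-- The extension of `pL(V)` by a representation `ρ` of its Lie algebra on `M`, with the product
`(a, m) * (b, n) = (a * b, -ρ b m)`. -/
def SquareZero (_ : FreePreLie k V →ₗ[k] M →ₗ[k] M) : Type _ := FreePreLie k V × M

variable (ρ : FreePreLie k V →ₗ[k] M →ₗ[k] M)

namespace SquareZero

instance : AddCommGroup (SquareZero ρ) := inferInstanceAs (AddCommGroup (FreePreLie k V × M))

instance : Module k (SquareZero ρ) := inferInstanceAs (Module k (FreePreLie k V × M))

/-- The element of the extension with given components. -/
def mk (a : FreePreLie k V) (m : M) : SquareZero ρ := (a, m)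

/-- The component in `pL(V)`. -/
def fst : SquareZero ρ →ₗ[k] FreePreLie k V := LinearMap.fst k _ _

/-- The component in `M`. -/
def snd : SquareZero ρ →ₗ[k] M := LinearMap.snd k _ _

instance : Mul (SquareZero ρ) where
  mul x y := mk ρ (fst ρ x * fst ρ y) (-ρ (fst ρ y) (snd ρ x))

variable {ρ}

@[ext]
theorem ext {x y : SquareZero ρ} (h1 : fst ρ x = fst ρ y) (h2 : snd ρ x = snd ρ y) : x = y :=
  Prod.ext h1 h2

@[simp] theorem fst_mk (a : FreePreLie k V) (m : M) : fst ρ (mk ρ a m) = a := rfl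
@[simp] theorem snd_mk (a : FreePreLie k V) (m : M) : snd ρ (mk ρ a m) = m := rfl
@[simp] theorem fst_mul (x y : SquareZero ρ) : fst ρ (x * y) = fst ρ x * fst ρ y := rfl
@[simp] theorem snd_mul (x y : SquareZero ρ) : snd ρ (x * y) = -ρ (fst ρ y) (snd ρ x) := rfl

instance : NonUnitalNonAssocRing (SquareZero ρ) where
  left_distrib a b c := by ext <;> simp [mul_add, add_comm]
  right_distrib a b c := by ext <;> simp [add_mul, add_comm]
  zero_mul a := by ext <;> simp
  mul_zero a := by ext <;> simp

instance : IsScalarTower k (SquareZero ρ) (SquareZero ρ) where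
  smul_assoc r a b := by ext <;> simp [smul_mul_assoc]

instance : SMulCommClass k (SquareZero ρ) (SquareZero ρ) where
  smul_comm r a b := by ext <;> simp [mul_smul_comm]

theorem fst_associator (x y z : SquareZero ρ) :
    fst ρ (associator x y z) = associator (fst ρ x) (fst ρ y) (fst ρ z) := by
  simp [associator_apply]

theorem snd_associator (x y z : SquareZero ρ) : snd ρ (associator x y z) =
    ρ (fst ρ z) (ρ (fst ρ y) (snd ρ x)) + ρ (fst ρ y * fst ρ z) (snd ρ x) := by
  simp [associator_apply]

/-- In the M-component, symmetry of ρ z ρ y + ρ (y * z) in y and z is the representation axiom. The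
minus sign in the product turns the left action into a right one. -/
theorem associator_symm (hρ : ∀ x y m, ρ ⁅x, y⁆ m = ρ x (ρ y m) - ρ y (ρ x m))
    (x y z : SquareZero ρ) : associator x y z = associator x z y := by
  ext
  · rw [fst_associator, fst_associator, RightPreLieRing.assoc_symm]
  · have h := hρ (fst ρ y) (fst ρ z) (snd ρ x)
    have e : ⁅fst ρ y, fst ρ z⁆ = fst ρ y * fst ρ z - fst ρ z * fst ρ y := rfl
    rw [e, map_sub, LinearMap.sub_apply] at h
    rw [snd_associator, snd_associator, ← sub_eq_zero, ← sub_eq_zero.2 h]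
    abel

variable (ρ)

/-- The images of the generators: `v ↦ (v, 0)` and `∘ ↦ (0, m)`. -/
def gen (m : M) : Option V → SquareZero ρ
  | none => mk ρ 0 m
  | some v => mk ρ (FreePreLie.ι k V v) 0

/-- The homomorphism from the free nonassociative algebra given by `gen`. -/
def homAux (m : M) : FreeNonUnitalNonAssocAlgebra k (Option V) →ₙₐ[k] SquareZero ρ :=
  FreeNonUnitalNonAssocAlgebra.lift k (gen ρ m)

theorem homAux_of (m : M) (g : Option V) : homAux ρ m (mono k (.of g)) = gen ρ m g :=
  FreeNonUnitalNonAssocAlgebra.lift_of_apply k _ g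

/-- The projection to pL(V) is multiplicative and kills the image of ∘, so every monomial containing
∘ lands in M. -/
theorem fst_homAux_eq_zero (m : M) (w : Mon V) (hw : deg w ≠ 0) :
    fst ρ (homAux ρ m (mono k w)) = 0 := by
  induction w using FreeMagma.recOnMul with
  | ih1 g =>
    cases g with
    | none => rw [homAux_of]; rfl
    | some v => exact absurd rfl hw
  | ih2 x y hx hy =>
    rw [mono_mul, map_mul, fst_mul]
    by_cases h : deg x = 0
    · rw [hy (fun h' => hw (by rw [deg_mul, h, h'])), mul_zero]
    · rw [hx h, zero_mul]

/-- The homomorphism `pL(V, ∘) → pL(V) ⊕ M` that is the identity on `V` and sends `∘` to `m`. -/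
def hom (hρ : ∀ x y m, ρ ⁅x, y⁆ m = ρ x (ρ y m) - ρ y (ρ x m)) (m : M) :
    GradedFree k V →ₙₐ[k] SquareZero ρ :=
  AlgQuot.lift k _ (homAux ρ m) (by
    intro x hx
    cases hx with
    | add v w =>
      simp only [map_sub, homAux_of]
      ext <;> simp [gen]
    | smul c v =>
      simp only [map_sub, map_smul, homAux_of]
      ext <;> simp [gen]
    | assoc x y z =>
      simp only [associator_apply, map_sub, map_smul, map_mul]
      rw [← associator_apply, ← associator_apply]
      rw [associator_symm hρ _ (homAux ρ m (mono k z))]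
      -- The associator is symmetric without sign, so the sign matters only if both degrees are
      -- nonzero. Then both entries lie in M, and right multiplication by M is zero.
      by_cases h : deg y = 0 ∨ deg z = 0
      · rw [mul_eq_zero.2 h, pow_zero, one_smul, sub_self]
      · rw [not_or] at h
        have hy := fst_homAux_eq_zero ρ m y h.1
        have hz := fst_homAux_eq_zero ρ m z h.2
        have e : associator (homAux ρ m (mono k x)) (homAux ρ m (mono k y))
            (homAux ρ m (mono k z)) = 0 := by
          ext
          · rw [fst_associator, hy, hz]; simp [associator_apply]
          · rw [snd_associator, hy, hz]; simp
        rw [e, smul_zero, sub_zero])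

variable (hρ : ∀ x y m, ρ ⁅x, y⁆ m = ρ x (ρ y m) - ρ y (ρ x m)) (m : M)

theorem hom_dummy : hom ρ hρ m (GradedFree.dummy k V) = mk ρ 0 m := homAux_of ρ m none

theorem hom_incl (x : FreePreLie k V) : hom ρ hρ m (Reduced.incl k V x) = mk ρ x 0 := by
  induction x using FreePreLie.induction with
  | hι v => rw [incl_ι]; exact homAux_of ρ m (some v)
  | hadd x y hx hy => rw [map_add, map_add, hx, hy]; ext <;> simp
  | hsmul r x hx => rw [map_smul, map_smul, hx]; ext <;> simp
  | hmul x y hx hy => rw [map_mul, map_mul, hx, hy]; ext <;> simp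

/-- If `V` annihilates `m`, then the differential of `pL(V)` computes the action on `m`. -/
theorem snd_hom_dTilde (hV : ∀ v, ρ (FreePreLie.ι k V v) m = 0) (x : FreePreLie k V) :
    snd ρ (hom ρ hρ m (GradedFree.dTilde k V (Reduced.incl k V x))) = ρ x m := by
  induction x using FreePreLie.induction with
  | hι v =>
    rw [hV, incl_ι]
    have : GradedFree.dTilde k V (GradedFree.ι k V v) = 0 := GradedFree.dTilde_ofMon _
    rw [this, map_zero, map_zero]
  | hadd x y hx hy => simp only [map_add, hx, hy, LinearMap.add_apply]
  | hsmul r x hx => simp only [map_smul, hx, LinearMap.smul_apply]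
  | hmul x y hx hy =>
    -- In the M-component, d x * y gives -ρ y ρ x m, x * d y gives 0, and Φ(∘, x, y) gives ρ y ρ x m
    -- + ρ (x * y) m. The sum is ρ (x * y) m.
    rw [dTilde_incl_mul]
    simp only [map_add, map_sub, map_mul, associator_apply, hom_incl, hom_dummy, snd_mul, fst_mul,
      fst_mk, snd_mk, hx, map_zero, neg_zero, map_neg]
    abel

end SquareZero

end SquareZero

/-- Apply the extension to a representation with a vector whose annihilator is exactly L(V). Since V
lies in L(V), it kills this vector, as `SquareZero.snd_hom_dTilde` requires. -/
theorem ker_d_le_lieElements {k : Type u} [Field k] {V : Type v} [AddCommGroup V] [Module k V] :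
    LinearMap.ker (d k V) ≤ (lieElements k V).toSubmodule := by
  intro x hx
  obtain ⟨M, _, _, ρ, m, hρ, hm⟩ := LieSubalgebra.exists_annihilator_eq (lieElements k V)
  have hV (v : V) : ρ (FreePreLie.ι k V v) m = 0 :=
    (hm _).2 (LieSubalgebra.subset_lieSpan ⟨v, rfl⟩)
  have h := SquareZero.snd_hom_dTilde ρ hρ m hV x
  rw [(d_eq_zero_iff x).1 hx, map_zero, map_zero] at h
  exact (hm x).1 h.symm

end PreLie

end

theorem mainTheorem1 (k : Type*) [Field k] [CharZero k] (V : Type*) [AddCommGroup V] [Module k V] :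
    (PreLie.lieElements k V).toSubmodule = LinearMap.ker (PreLie.d k V) :=
  le_antisymm PreLie.lieElements_le_ker_d PreLie.ker_d_le_lieElements
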